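/- Let $q_n=t_n-\delta_{n,1}$ ($n\ge 0$) and $\partial_n=\partial/\partial t_n$. Let $GW_0$ be the set of formal power series $F\in\mathbb C[[t_0,t_1,t_2,\dots]]$ satisfying the dilaton equation, the string equation and the genus-zero topological recursion relations of rank $N=\dim H=1$ (with $H=\mathbb C\mathbf 1$, $(\mathbf 1,\mathbf 1)=1$): $$\text{(DE)}\ \sum_{i\ge0}q_i\,\partial_iF=2F,\qquad \text{(SE)}\ \sum_{i\ge0}q_{i+1}\,\partial_iF=-\tfrac12q_0^2,$$ $$\text{(TRR)}\ \ \partial_{k+1}\partial_l\partial_mF=(\partial_k\partial_0F)\,(\partial_0\partial_l\partial_mF)\qquad(k,l,m\ge0).$$ Let $G_-$ be the group of series $S(z)=1+\sum_{i>0}S_iz^{-i}\in\mathbb C[[z^{-1}]]$ with $S(-z)S(z)=1$, and let the string flow be its subgroup $\{\exp(az^{-1}):a\in\mathbb C\}$. Put $\mathbf q(z)=\sum_{n\ge0}q_nz^n$. For $S\in G_-$ and a potential $F$ set $$(S\cdot F)(\mathbf q)=F\big([S^{-1}(z)\mathbf q(z)]_+\big)+\tfrac12\sum_{k,l\ge0}W_{k,l}\,q_kq_l,\qquad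 \sum_{k,l\ge0}\frac{W_{k,l}}{z^kw^l}=\frac{S^{-1}(w)S^{-1}(z)-1}{z^{-1}+w^{-1}},$$ where $[\cdot]_+$ is the truncation to non-negative powers of $z$; that is, the argument of $F$ has the shifted coordinates $q_i'=\sum_{n\ge0}(S^{-1})_n\,q_{i+n}$. Let $$F_0^{pt}=\sum_{n\ge3}\frac1{n!}\sum_{i_1,\dots,i_n\ge0}t_{i_1}\cdots t_{i_n}\int_{\overline{\mathcal M}_{0,n}}\psi_1^{i_1}\cdots\psi_n^{i_n}$$ be the genus-zero Gromov–Witten potential of a point, where the integral equals $\frac{(n-3)!}{i_1!\cdots i_n!}$ if $i_1+\dots+i_n=n-3$ and $0$ otherwise. **Theorem.** (1) The map $$(a_3,a_5,a_7,\dots)\longmapsto \exp\Big(\sum_{i\ge1}a_{2i+1}z^{-2i-1}\Big)\cdot F_0^{pt}$$ is a bijection from the set of all sequences of complex numbers $(a_3,a_5,\dots)$ onto $GW_0$, and every series $\exp(\sum_{i\ge1}a_{2i+1}z^{-2i-1})$ belongs to $G_-$. (2) For all $S\in G_-$ and $F\in GW_0$ the substitution $F([S^{-1}(z)\mathbf q(z)]_+)$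 is well defined (each coefficient of the result is a finite sum), the formula above defines an action of $G_-$ on $GW_0$ on which the string flow acts trivially, and the induced action of the quotient of $G_-$ by the string flow on $GW_0$ is simply transitive. -/

import Mathlib

namespace FormalGW

open MvPowerSeries

/-- Functions on the big phase space for `dim H = 1` (with basis vector `1`, `(1, 1) = 1`):
formal power series over `ℂ` in the coordinates `t_0, t_1, t_2, …`. -/
abbrev Potential : Type := MvPowerSeries ℕ ℂ

/-- A family of power series is locally finite if each monomial occurs in finitely many members. -/
def IsLocallyFinite {ι : Type*} (f : ι → Potential) : Prop :=
  ∀ d : ℕ →₀ ℕ, {i | coeff d (f i) ≠ 0}.Finite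

/-- The sum of a locally finite family of power series, computed coefficient by coefficient. -/
noncomputable def formalSum {ι : Type*} (f : ι → Potential) : Potential :=
  fun d => ∑ᶠ i, coeff d (f i)

/-- The dilaton shift `δ_{n,1}`. -/
noncomputable def shift (n : ℕ) : Potential := if n = 1 then 1 else 0

/-- The dilaton-shifted coordinate `q_n = t_n - δ_{n,1}`. -/
noncomputable def q (n : ℕ) : Potential := X n - shift n

/-- Dilaton equation: `∑_i q_i ∂_i F = 2 F`. -/
def DilatonEq (F : Potential) : Prop :=
  formalSum (fun i : ℕ => q i * pderiv ℂ i F) = 2 * F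

/-- String equation: `∑_i q_{i+1} ∂_i F = - q_0² / 2`. -/
def StringEq (F : Potential) : Prop :=
  formalSum (fun i : ℕ => q (i + 1) * pderiv ℂ i F) = -((1 / 2 : ℂ) • q 0 ^ 2)

/-- Topological recursion relations:
`∂_{k+1} ∂_l ∂_m F = (∂_k ∂_0 F) (∂_0 ∂_l ∂_m F)` for all `k, l, m ≥ 0`. -/
def TopologicalRecursion (F : Potential) : Prop :=
  ∀ k l m : ℕ, pderiv ℂ (k + 1) (pderiv ℂ l (pderiv ℂ m F)) =
    pderiv ℂ k (pderiv ℂ 0 F) * pderiv ℂ 0 (pderiv ℂ l (pderiv ℂ m F))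

/-- The set of axiomatic genus zero theories of rank one. -/
def GW0 : Set Potential :=
  {F | DilatonEq F ∧ StringEq F ∧ TopologicalRecursion F}

/-- The genus zero descendant integral `∫_{M̄_{0,n}} ψ_1^{k_1} ⋯ ψ_n^{k_n}`. It vanishes unless
`k_1 + ⋯ + k_n = dim M̄_{0,n} = n - 3`, and then it is `(n - 3)! / (k_1! ⋯ k_n!)`. -/
noncomputable def psiIntegral {n : ℕ} (k : Fin n → ℕ) : ℂ :=
  if (∑ j, k j) + 3 = n then ((n - 3).factorial : ℂ) / ∏ j, ((k j).factorial : ℂ) else 0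

/-- The genus zero Gromov-Witten potential of a point,
`∑_{n ≥ 3} (1 / n!) ∑_{i_1, …, i_n ≥ 0} t_{i_1} ⋯ t_{i_n} ∫_{M̄_{0,n}} ψ_1^{i_1} ⋯ ψ_n^{i_n}`.
The coefficient of the monomial `t^d` collects the tuples with `t_{i_1} ⋯ t_{i_n} = t^d`;
these have `n = deg d`. -/
noncomputable def pointPotential : Potential := fun d =>
  if 3 ≤ d.degree then
    (1 / (d.degree.factorial : ℂ)) *
      ∑ᶠ (i : Fin d.degree → ℕ) (_ : ∑ j, Finsupp.single (i j) 1 = d), psiIntegral i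
  else 0

/-- The lower-triangular group `G_-` for `dim H = 1`: the series `S = 1 + S_1 z⁻¹ + S_2 z⁻² + ⋯`
with `S(-z) S(z) = 1`. The variable of the power series is `z⁻¹`. -/
noncomputable def Gminus : Subgroup (PowerSeries ℂ)ˣ where
  carrier := {S | PowerSeries.constantCoeff (S : PowerSeries ℂ) = 1 ∧
    PowerSeries.rescale (-1 : ℂ) (S : PowerSeries ℂ) * (S : PowerSeries ℂ) = 1}
  one_mem' := by simp
  mul_mem' := by
    rintro S T ⟨hS, hS'⟩ ⟨hT, hT'⟩
    refine ⟨by simp [hS, hT], ?_⟩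
    rw [Units.val_mul, map_mul, mul_mul_mul_comm, hS', hT', mul_one]
  inv_mem' := by
    rintro S ⟨hS, hS'⟩
    have h1 : (S : PowerSeries ℂ) * ((S⁻¹ : (PowerSeries ℂ)ˣ) : PowerSeries ℂ) = 1 := S.mul_inv
    have h2 := congrArg PowerSeries.constantCoeff h1
    have h3 := congrArg (PowerSeries.rescale (-1 : ℂ)) h1
    rw [map_mul, hS, one_mul, map_one] at h2
    rw [map_mul, map_one] at h3
    refine ⟨h2, ?_⟩
    calc _ = (PowerSeries.rescale (-1 : ℂ) (S : PowerSeries ℂ) * (S : PowerSeries ℂ)) *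
          (PowerSeries.rescale (-1 : ℂ) ((S⁻¹ : (PowerSeries ℂ)ˣ) : PowerSeries ℂ) *
            ((S⁻¹ : (PowerSeries ℂ)ˣ) : PowerSeries ℂ)) := by rw [hS', one_mul]
      _ = 1 := by rw [mul_mul_mul_comm, h3, h1, mul_one]

/-- The string flow `{exp(a z⁻¹) : a ∈ ℂ}`, a subgroup of `G_-`. -/
noncomputable def stringFlow : Subgroup Gminus where
  carrier := {S | ∃ a : ℂ,
    ((S : (PowerSeries ℂ)ˣ) : PowerSeries ℂ) = PowerSeries.rescale a (PowerSeries.exp ℂ)}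
  one_mem' := ⟨0, by simp [PowerSeries.rescale_zero]⟩
  mul_mem' := by
    rintro S T ⟨a, ha⟩ ⟨b, hb⟩
    exact ⟨a + b, by
      rw [Subgroup.coe_mul, Units.val_mul, ha, hb, PowerSeries.exp_mul_exp_eq_exp_add]⟩
  inv_mem' := by
    rintro S ⟨a, ha⟩
    refine ⟨-a, ?_⟩
    rw [Subgroup.coe_inv]
    refine Units.inv_eq_of_mul_eq_one_right ?_
    rw [ha, PowerSeries.exp_mul_exp_eq_exp_add]
    simp [PowerSeries.rescale_zero]

/-- The series `exp(∑_{i ≥ 1} a_{2i+1} z^{-2i-1})` attached to `(a_3, a_5, a_7, …)`. -/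
noncomputable def oddExp (a : {n : ℕ // Odd n ∧ 3 ≤ n} → ℂ) : PowerSeries ℂ :=
  (PowerSeries.exp ℂ).subst
    (PowerSeries.mk fun n => if h : Odd n ∧ 3 ≤ n then a ⟨n, h⟩ else 0)

/-- The coefficient `q'_i = ∑_n (S⁻¹)_n q_{i+n}` of `z^i` in `[S⁻¹(z) q(z)]_+`. -/
noncomputable def qNew (S : PowerSeries ℂ) (i : ℕ) : Potential :=
  formalSum fun n : ℕ => (PowerSeries.coeff n S⁻¹) • q (i + n)

/-- The terms `F_d (t')^d` of the substitution of `t'_i = q'_i + δ_{i,1}` for `t_i` in `F`. -/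
noncomputable def substTerm (S : PowerSeries ℂ) (F : Potential) (d : ℕ →₀ ℕ) : Potential :=
  coeff d F • d.prod fun i e => (qNew S i + shift i) ^ e

/-- The coefficients `W_{k,l}` of `(S⁻¹(w) S⁻¹(z) - 1) / (z⁻¹ + w⁻¹) = ∑ W_{k,l} z^{-k} w^{-l}`;
see `W_spec`. -/
noncomputable def W (S : PowerSeries ℂ) (k l : ℕ) : ℂ :=
  ∑ m ∈ Finset.range (l + 1),
    (-1) ^ m * PowerSeries.coeff (k + 1 + m) S⁻¹ * PowerSeries.coeff (l - m) S⁻¹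

/-- The coefficients of `z^{-k} w^{-l}` in
`(z⁻¹ + w⁻¹) ∑ W_{k,l} z^{-k} w^{-l} = S⁻¹(w) S⁻¹(z) - 1`. -/
theorem W_spec (S : Gminus) (k l : ℕ) :
    (if k = 0 then 0 else W ((S : (PowerSeries ℂ)ˣ) : PowerSeries ℂ) (k - 1) l) +
      (if l = 0 then 0 else W ((S : (PowerSeries ℂ)ˣ) : PowerSeries ℂ) k (l - 1)) =
    PowerSeries.coeff l ((S : (PowerSeries ℂ)ˣ) : PowerSeries ℂ)⁻¹ *
      PowerSeries.coeff k ((S : (PowerSeries ℂ)ˣ) : PowerSeries ℂ)⁻¹ -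
      (if k = 0 ∧ l = 0 then 1 else 0) := by
  obtain ⟨S, hS⟩ := S
  have hinv := Gminus.inv_mem hS
  have hc : PowerSeries.constantCoeff (S : PowerSeries ℂ) ≠ 0 := by rw [hS.1]; exact one_ne_zero
  have he : ((S⁻¹ : (PowerSeries ℂ)ˣ) : PowerSeries ℂ) = (S : PowerSeries ℂ)⁻¹ := by
    refine (PowerSeries.eq_inv_iff_mul_eq_one hc).2 ?_
    exact S.inv_mul
  change _ ∧ _ at hinv
  rw [he] at hinv
  obtain ⟨h0, h1⟩ := hinv
  rw [← PowerSeries.coeff_zero_eq_constantCoeff_apply] at h0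
  simp only [W]
  generalize (S : PowerSeries ℂ)⁻¹ = R at *
  rcases k with _ | k
  · rcases l with _ | l
    · simp [h0]
    · have h := congrArg (PowerSeries.coeff (l + 1)) h1
      rw [PowerSeries.coeff_mul, Finset.Nat.sum_antidiagonal_eq_sum_range_succ_mk,
        Finset.sum_range_succ'] at h
      simp only [PowerSeries.coeff_rescale, PowerSeries.coeff_one] at h
      simp only [Nat.add_sub_add_right, pow_succ, h0] at h
      simp only [h0]
      simp at h ⊢
      simp only [add_comm 1]
      exact neg_add_eq_zero.1 h
  · rcases l with _ | l
    · simp [h0]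
    · rw [Finset.sum_range_succ']
      simp
      rw [add_right_comm, ← Finset.sum_add_distrib, Finset.sum_eq_zero, zero_add, mul_comm]
      intro m _
      rw [show k + 1 + (m + 1) = k + 1 + 1 + m by ring]
      ring

/-- The action of `S ∈ G_-` on a potential:
`(S F)(q) = F([S⁻¹(z) q(z)]_+) + (1 / 2) ∑_{k,l} W_{k,l} q_k q_l`. -/
noncomputable def act (S : PowerSeries ℂ) (F : Potential) : Potential :=
  formalSum (substTerm S F) +
    (1 / 2 : ℂ) • formalSum fun p : ℕ × ℕ => W S p.1 p.2 • (q p.1 * q p.2)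

end FormalGW

/-! Write `x` for `z⁻¹`. A theory is encoded by a series `J(x)` with `J(0) = 1`, `J(-x) J(x) = 1`
and a potential `v`. Put `A(x) = J(x) exp(v x)`, let `ell` be the functional `x^n ↦ q_n`, and let
`U_{kl}` be the coefficients of `(A(x) A(y) - 1) / (x + y)`. The pair represents `F` when `ell A =
0` and `F = (1/2) ∑ U_{kl} q_k q_l`.

The `v`-derivative of `U` is `A(x) A(y)`, which `ell` kills. Hence `∂_k ∂_l F = U_{kl}`, and DE, SE
and TRR follow (`Represents.mem_GW0`). Conversely, the equations force the second derivatives of any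
`F` in `GW0` to be such a quotient, with `A = 1 + ∑ (∂_0 ∂_k F) x^{k+1}` and `J` the value of `A` at
`t = 0` (`exists_represents`).

The equation `ell A = 0` has exactly one solution `v` for each `J`, by a contraction argument. As
`F` determines `A`, it determines `J` up to a factor `exp(a x)`, which a translation of `v` absorbs.
Substituting `[S⁻¹ q]_+` turns `A` into `S⁻¹ A`, and the form `W` is the correction that this makes
in `U`; so `S` sends `J` to `S⁻¹ J` (`Represents.act`). Thus `GW0` is a torsor under `G_-` modulo
the string flow.

The point corresponds to `J = 1`: a series with the dimension constraint is determined by the string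
equation. Finally the logarithm of an element of `G_-` is odd, so each coset of the string flow has
exactly one representative without linear exponent. -/

namespace FormalGW

open MvPowerSeries
open scoped MvPowerSeries.WithPiTopology

/-! ### Locally finite families and their sums -/

section LocallyFinite

variable {ι κ : Type*}

theorem IsLocallyFinite.hasSum {f : ι → Potential} (hf : IsLocallyFinite f) :
    HasSum f (formalSum f) := by
  rw [WithPiTopology.hasSum_iff_hasSum_coeff]
  intro d
  have h : coeff d (formalSum f) = ∑ i ∈ (hf d).toFinset, coeff d (f i) :=
    finsum_eq_sum_of_support_subset _ (by intro i hi; simpa using hi)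
  rw [h]
  refine hasSum_sum_of_ne_finset_zero fun i hi => ?_
  simpa using hi

theorem IsLocallyFinite.formalSum_eq {f : ι → Potential} (hf : IsLocallyFinite f) {a : Potential}
    (h : HasSum f a) : formalSum f = a :=
  hf.hasSum.unique h

theorem IsLocallyFinite.mul {f : ι → Potential} {g : κ → Potential}
    (hf : IsLocallyFinite f) (hg : IsLocallyFinite g) :
    IsLocallyFinite fun p : ι × κ => f p.1 * g p.2 := by
  classical
  intro d
  refine Set.Finite.subset (s := ⋃ e ∈ Finset.HasAntidiagonal.antidiagonal d,
    ({i | coeff e.1 (f i) ≠ 0} ×ˢ {j | coeff e.2 (g j) ≠ 0}))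
    (Set.Finite.biUnion (Finset.finite_toSet _) fun e _ => (hf _).prod (hg _)) ?_
  rintro ⟨i, j⟩ h
  simp only [Set.mem_ofPred_eq, coeff_mul] at h
  obtain ⟨e, he, h⟩ := Finset.exists_ne_zero_of_sum_ne_zero h
  simp only [Set.mem_iUnion, Set.mem_prod, Set.mem_ofPred_eq]
  exact ⟨e, he, left_ne_zero_of_mul h, right_ne_zero_of_mul h⟩

theorem IsLocallyFinite.mul_left {f : ι → Potential} (hf : IsLocallyFinite f)
    (c : ι → Potential) : IsLocallyFinite fun i => c i * f i := by
  classical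
  intro d
  refine Set.Finite.subset (s := ⋃ e ∈ Finset.HasAntidiagonal.antidiagonal d, {i | coeff e.2 (f i) ≠ 0})
    (Set.Finite.biUnion (Finset.finite_toSet _) fun e _ => hf _) ?_
  intro i h
  simp only [Set.mem_ofPred_eq, coeff_mul] at h
  obtain ⟨e, he, h⟩ := Finset.exists_ne_zero_of_sum_ne_zero h
  simp only [Set.mem_iUnion, Set.mem_ofPred_eq]
  exact ⟨e, he, right_ne_zero_of_mul h⟩

theorem IsLocallyFinite.comp_injective {f : ι → Potential} (hf : IsLocallyFinite f)
    {g : κ → ι} (hg : Function.Injective g) : IsLocallyFinite fun k => f (g k) :=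
  fun d => (hf d).preimage hg.injOn

theorem IsLocallyFinite.add {f g : ι → Potential} (hf : IsLocallyFinite f)
    (hg : IsLocallyFinite g) : IsLocallyFinite fun i => f i + g i := by
  intro d
  refine ((hf d).union (hg d)).subset fun i hi => ?_
  by_contra h
  simp only [Set.mem_union, Set.mem_ofPred_eq, not_or, not_not] at h
  exact hi (by simp [h])

theorem IsLocallyFinite.smul {f : ι → Potential} (hf : IsLocallyFinite f) (a : ι → ℂ) :
    IsLocallyFinite fun i => a i • f i := by
  simpa only [smul_eq_C_mul] using hf.mul_left fun i => C (a i)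

end LocallyFinite

/-! ### Linear and quadratic expressions in the shifted coordinates -/

theorem continuous_pderiv (i : ℕ) : Continuous (pderiv ℂ i : Potential → Potential) := by
  refine continuous_pi fun d => ?_
  have h : (fun F : Potential => pderiv ℂ i F d) =
      fun F => coeff (d + Finsupp.single i 1) F * ((d i : ℂ) + 1) := by
    funext F
    exact coeff_pderiv F d
  rw [h]
  exact (WithPiTopology.continuous_coeff ℂ _).mul continuous_const

theorem hasSum_pderiv {ι : Type*} {f : ι → Potential} {a : Potential} (h : HasSum f a) (i : ℕ) :
    HasSum (fun j => pderiv ℂ i (f j)) (pderiv ℂ i a) :=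
  h.map (pderiv ℂ i) (continuous_pderiv i)

theorem isLocallyFinite_X : IsLocallyFinite fun n => (X n : Potential) := by
  intro d
  refine Set.Subsingleton.finite fun i hi j hj => ?_
  simp only [Set.mem_ofPred_eq, coeff_X, ne_eq, ite_eq_right_iff, one_ne_zero, imp_false,
    not_not] at hi hj
  rw [hi] at hj
  simpa [Finsupp.single_left_inj] using hj

theorem isLocallyFinite_shift : IsLocallyFinite shift := by
  intro d
  refine (Set.finite_singleton 1).subset fun i hi => ?_
  by_contra h
  exact hi (by rw [shift, if_neg (by simpa using h), map_zero])

theorem isLocallyFinite_q : IsLocallyFinite q := by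
  have h := isLocallyFinite_X.add (isLocallyFinite_shift.smul fun _ => -1)
  have h' : q = fun i => X i + (-1 : ℂ) • shift i := by
    funext i
    rw [q, neg_one_smul, sub_eq_add_neg]
  rwa [h']

/-- The linear functional `∑ c_n x^n ↦ ∑ c_n q_n`. -/
noncomputable def ell : PowerSeries Potential →ₗ[Potential] Potential where
  toFun c := formalSum fun n => PowerSeries.coeff n c * q n
  map_add' a b := by
    refine (isLocallyFinite_q.mul_left _).formalSum_eq ?_
    simp only [map_add, add_mul]
    exact (isLocallyFinite_q.mul_left _).hasSum.add (isLocallyFinite_q.mul_left _).hasSum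
  map_smul' a b := by
    refine (isLocallyFinite_q.mul_left _).formalSum_eq ?_
    simp only [map_smul, smul_eq_mul, mul_assoc, RingHom.id_apply]
    exact (isLocallyFinite_q.mul_left _).hasSum.mul_left a

theorem hasSum_ell (c : PowerSeries Potential) :
    HasSum (fun n => PowerSeries.coeff n c * q n) (ell c) :=
  (isLocallyFinite_q.mul_left _).hasSum

theorem ell_C_mul (a : Potential) (c : PowerSeries Potential) :
    ell (PowerSeries.C a * c) = a * ell c := by
  rw [← PowerSeries.smul_eq_C_mul, map_smul, smul_eq_mul]

/-- The bilinear form `∑ U_{kl} y^k x^l ↦ ∑ U_{kl} q_k q_l`. -/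
noncomputable def bil (U : PowerSeries (PowerSeries Potential)) : Potential :=
  ell (PowerSeries.mk fun k => ell (PowerSeries.coeff k U))

theorem hasSum_ell_X (c : PowerSeries Potential) :
    HasSum (fun n => PowerSeries.coeff n c * X n) (ell c + PowerSeries.coeff 1 c) := by
  have h : HasSum (fun n => PowerSeries.coeff n c * shift n) (PowerSeries.coeff 1 c) := by
    convert hasSum_single (f := fun n => PowerSeries.coeff n c * shift n) 1 ?_ using 1
    · simp [shift]
    · intro n hn
      simp [shift, hn]
  convert (hasSum_ell c).add h using 2 with n
  rw [q]; ring

/-- Because `q_1 = t_1 - 1`, the coefficient at `d` involves strictly lower degrees, except for the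
contribution of `c_1`. All later inductions on degree rest on this. -/
theorem coeff_ell (c : PowerSeries Potential) (d : ℕ →₀ ℕ) :
    coeff d (ell c) =
      ∑ n ∈ d.support, coeff (d - Finsupp.single n 1) (PowerSeries.coeff n c) -
        coeff d (PowerSeries.coeff 1 c) := by
  rw [eq_sub_iff_add_eq, ← map_add]
  refine HasSum.unique (WithPiTopology.hasSum_iff_hasSum_coeff.1 (hasSum_ell_X c) d) ?_
  have h (n : ℕ) : coeff d (PowerSeries.coeff n c * X n) =
      if n ∈ d.support then coeff (d - Finsupp.single n 1) (PowerSeries.coeff n c) else 0 := by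
    rw [X_def, coeff_mul_monomial, mul_one]
    simp [Nat.one_le_iff_ne_zero]
  simp only [h]
  rw [← Finset.sum_congr rfl fun n hn => if_pos hn]
  exact hasSum_sum_of_ne_finset_zero fun n hn => if_neg hn

theorem pderiv_q (m n : ℕ) : pderiv ℂ m (q n) = if n = m then 1 else 0 := by
  have : pderiv ℂ m (shift n) = 0 := by
    unfold shift
    split_ifs
    · rw [← map_one C, pderiv_C]
    · rw [map_zero]
  rw [q, map_sub, this, sub_zero]
  split_ifs with h
  · rw [h, pderiv_X_self]
  · exact pderiv_X_of_ne h

/-- Differentiation of the coefficients of a power series over the potentials. -/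
noncomputable def coeffDeriv (m : ℕ) (c : PowerSeries Potential) : PowerSeries Potential :=
  PowerSeries.mk fun n => pderiv ℂ m (PowerSeries.coeff n c)

theorem pderiv_ell (m : ℕ) (c : PowerSeries Potential) :
    pderiv ℂ m (ell c) = ell (coeffDeriv m c) + PowerSeries.coeff m c := by
  refine (hasSum_pderiv (hasSum_ell c) m).unique ?_
  have h : HasSum (fun n => PowerSeries.coeff n c * pderiv ℂ m (q n)) (PowerSeries.coeff m c) := by
    convert hasSum_single (f := fun n => PowerSeries.coeff n c * pderiv ℂ m (q n)) m ?_ using 1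
    · simp [pderiv_q]
    · intro n hn
      simp [pderiv_q, hn]
  convert (hasSum_ell (coeffDeriv m c)).add h using 2 with n
  rw [Derivation.leibniz, smul_eq_mul, smul_eq_mul, coeffDeriv, PowerSeries.coeff_mk]
  ring

/-- The family `y` is kept general so that the lemma covers both `q_n` and the transformed
coordinates `q'_n`. -/
theorem hasSum_mul_family {y : ℕ → Potential} (hy : IsLocallyFinite y)
    (U : PowerSeries (PowerSeries Potential)) (f : PowerSeries Potential →ₗ[Potential] Potential)
    (hf : ∀ c, HasSum (fun n => PowerSeries.coeff n c * y n) (f c)) :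
    HasSum (fun p : ℕ × ℕ => PowerSeries.coeff p.2 (PowerSeries.coeff p.1 U) * (y p.1 * y p.2))
      (f (PowerSeries.mk fun k => f (PowerSeries.coeff k U))) := by
  have h := ((hy.mul hy).mul_left fun p => PowerSeries.coeff p.2 (PowerSeries.coeff p.1 U)).hasSum
  have h1 := h.prod_fiberwise (g := fun k => f (PowerSeries.coeff k U) * y k) fun k => by
    have h' := (hf (PowerSeries.coeff k U)).mul_right (y k)
    simpa only [mul_assoc, mul_comm (y k)] using h'
  have h2 := hf (PowerSeries.mk fun k => f (PowerSeries.coeff k U))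
  simp only [PowerSeries.coeff_mk] at h2
  rwa [h1.unique h2] at h

theorem hasSum_bil (U : PowerSeries (PowerSeries Potential)) :
    HasSum (fun p : ℕ × ℕ => PowerSeries.coeff p.2 (PowerSeries.coeff p.1 U) * (q p.1 * q p.2))
      (bil U) :=
  hasSum_mul_family isLocallyFinite_q U ell hasSum_ell

theorem bil_add (U V : PowerSeries (PowerSeries Potential)) : bil (U + V) = bil U + bil V := by
  rw [bil, bil, bil, ← map_add]
  congr 1
  ext1 k
  simp

theorem bil_C_mul_map_C (a b : PowerSeries Potential) :
    bil (PowerSeries.C a * PowerSeries.map PowerSeries.C b) = ell a * ell b := by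
  have h : (PowerSeries.mk fun k => ell (PowerSeries.coeff k
      (PowerSeries.C a * PowerSeries.map PowerSeries.C b))) = PowerSeries.C (ell a) * b := by
    ext1 k
    rw [PowerSeries.coeff_mk, PowerSeries.coeff_C_mul, PowerSeries.coeff_map, mul_comm a,
      ell_C_mul, PowerSeries.coeff_C_mul, mul_comm]
  rw [bil, h, ell_C_mul]

theorem bil_swap (U V : PowerSeries (PowerSeries Potential))
    (h : ∀ k l, PowerSeries.coeff l (PowerSeries.coeff k U) =
      PowerSeries.coeff k (PowerSeries.coeff l V)) : bil U = bil V := by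
  refine (hasSum_bil U).unique ?_
  convert (Equiv.prodComm ℕ ℕ).hasSum_iff.2 (hasSum_bil V) using 2 with p
  simp [h, mul_comm]

end FormalGW

/-! ### The series `J(x) exp(v x)` and the quotient `(A(x) A(y) - 1) / (x + y)` -/

namespace FormalGW

open MvPowerSeries
open scoped MvPowerSeries.WithPiTopology

/-- The series `J(x) exp(v x)` over the potentials. -/
noncomputable def jet (J : PowerSeries ℂ) (v : Potential) : PowerSeries Potential :=
  PowerSeries.map C J * PowerSeries.rescale v (PowerSeries.exp Potential)

theorem coeff_exp_potential (n : ℕ) :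
    PowerSeries.coeff n (PowerSeries.exp Potential) = C ((n.factorial : ℂ)⁻¹) := by
  rw [PowerSeries.coeff_exp, IsScalarTower.algebraMap_apply ℚ ℂ Potential]
  simp [MvPowerSeries.algebraMap_apply]

theorem coeff_jet (J : PowerSeries ℂ) (v : Potential) (n : ℕ) :
    PowerSeries.coeff n (jet J v) = ∑ p ∈ Finset.HasAntidiagonal.antidiagonal n,
      C (PowerSeries.coeff p.1 J * (p.2.factorial : ℂ)⁻¹) * v ^ p.2 := by
  rw [jet, PowerSeries.coeff_mul]
  refine Finset.sum_congr rfl fun p _ => ?_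
  rw [PowerSeries.coeff_map, PowerSeries.coeff_rescale, coeff_exp_potential, map_mul]
  ring

theorem coeff_zero_jet (J : PowerSeries ℂ) (v : Potential) :
    PowerSeries.coeff 0 (jet J v) = C (PowerSeries.coeff 0 J) := by
  simp [coeff_jet]

theorem coeff_one_jet (J : PowerSeries ℂ) (v : Potential) :
    PowerSeries.coeff 1 (jet J v) = C (PowerSeries.coeff 1 J) + C (PowerSeries.coeff 0 J) * v := by
  simp [coeff_jet, Finset.Nat.antidiagonal_succ]
  ring

theorem jet_map_mul (S J : PowerSeries ℂ) (v : Potential) :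
    PowerSeries.map C S * jet J v = jet (S * J) v := by
  rw [jet, jet, map_mul, mul_assoc]

theorem map_rescale_exp (a : ℂ) : PowerSeries.map C (PowerSeries.rescale a (PowerSeries.exp ℂ)) =
    PowerSeries.rescale (C a : Potential) (PowerSeries.exp Potential) := by
  ext1 n
  rw [PowerSeries.coeff_map, PowerSeries.coeff_rescale, PowerSeries.coeff_rescale,
    coeff_exp_potential, PowerSeries.coeff_exp]
  simp

/-- This is why the string flow acts trivially: an exponential factor of `J` is absorbed by
translating `v`. -/
theorem jet_mul_exp (J : PowerSeries ℂ) (v : Potential) (a : ℂ) :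
    jet (J * PowerSeries.rescale a (PowerSeries.exp ℂ)) v = jet J (C a + v) := by
  rw [jet, jet, map_mul, map_rescale_exp, mul_assoc, PowerSeries.exp_mul_exp_eq_exp_add]

/-- The twisted orthogonality `A(-x) A(x) = 1` together with `A(0) = 1`. -/
def IsSymplectic {R : Type*} [CommRing R] (A : PowerSeries R) : Prop :=
  PowerSeries.constantCoeff A = 1 ∧ PowerSeries.rescale (-1 : R) A * A = 1

theorem IsSymplectic.map {R R' : Type*} [CommRing R] [CommRing R'] {A : PowerSeries R}
    (h : IsSymplectic A) (f : R →+* R') : IsSymplectic (PowerSeries.map f A) := by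
  refine ⟨by rw [← PowerSeries.coeff_zero_eq_constantCoeff_apply, PowerSeries.coeff_map,
    PowerSeries.coeff_zero_eq_constantCoeff_apply, h.1, map_one], ?_⟩
  have := congrArg (PowerSeries.map f) h.2
  rw [map_mul, map_one] at this
  convert this using 2
  ext1 n
  simp [PowerSeries.coeff_rescale]

theorem IsSymplectic.mul {R : Type*} [CommRing R] {A B : PowerSeries R} (hA : IsSymplectic A)
    (hB : IsSymplectic B) : IsSymplectic (A * B) := by
  refine ⟨by rw [map_mul, hA.1, hB.1, one_mul], ?_⟩
  rw [map_mul, mul_mul_mul_comm, hA.2, hB.2, one_mul]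

theorem isSymplectic_rescale_exp {R : Type*} [CommRing R] [Algebra ℚ R] (v : R) :
    IsSymplectic (PowerSeries.rescale v (PowerSeries.exp R)) := by
  refine ⟨?_, ?_⟩
  · rw [← PowerSeries.coeff_zero_eq_constantCoeff_apply, PowerSeries.coeff_rescale, pow_zero,
      one_mul, PowerSeries.coeff_zero_eq_constantCoeff_apply, PowerSeries.constantCoeff_exp]
  rw [PowerSeries.rescale_rescale, PowerSeries.exp_mul_exp_eq_exp_add]
  simp [PowerSeries.rescale_zero]

theorem IsSymplectic.jet {J : PowerSeries ℂ} (h : IsSymplectic J) (v : Potential) :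
    IsSymplectic (jet J v) :=
  (h.map C).mul (isSymplectic_rescale_exp v)

/-- The coefficients `U_{kl}` of `(A(x) A(y) - 1) / (x + y)`. -/
noncomputable def quot {R : Type*} [CommRing R] (A : PowerSeries R) (k l : ℕ) : R :=
  ∑ m ∈ Finset.range (l + 1),
    (-1) ^ m * PowerSeries.coeff (k + 1 + m) A * PowerSeries.coeff (l - m) A

theorem quot_zero_right {R : Type*} [CommRing R] (A : PowerSeries R) (k : ℕ) :
    quot A k 0 = PowerSeries.coeff (k + 1) A * PowerSeries.coeff 0 A := by
  simp [quot]

/-- The coefficient form of multiplication by `x + y`; no symplectic condition is needed away from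
the row `k = 0`. -/
theorem quot_succ_right {R : Type*} [CommRing R] (A : PowerSeries R) (k l : ℕ) :
    quot A k (l + 1) = PowerSeries.coeff (k + 1) A * PowerSeries.coeff (l + 1) A -
      quot A (k + 1) l := by
  rw [quot, Finset.sum_range_succ', quot, sub_eq_neg_add, ← Finset.sum_neg_distrib]
  congr 1
  · refine Finset.sum_congr rfl fun m _ => ?_
    rw [show k + 1 + (m + 1) = k + 1 + 1 + m by ring, Nat.add_sub_add_right]
    ring
  · simp

/-- The coefficient of `x^{l+1}` in `A(-x) A(x)` is `A_{l+1}` minus the alternating sum that defines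
`quot A 0 l`. -/
theorem isSymplectic_iff {R : Type*} [CommRing R] {A : PowerSeries R} :
    IsSymplectic A ↔
      PowerSeries.coeff 0 A = 1 ∧ ∀ l, quot A 0 l = PowerSeries.coeff (l + 1) A := by
  rw [IsSymplectic, ← PowerSeries.coeff_zero_eq_constantCoeff_apply]
  refine and_congr_right fun h0 => ?_
  have h (l : ℕ) : PowerSeries.coeff (l + 1) (PowerSeries.rescale (-1 : R) A * A) =
      PowerSeries.coeff (l + 1) A - quot A 0 l := by
    rw [PowerSeries.coeff_mul, Finset.Nat.sum_antidiagonal_eq_sum_range_succ_mk,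
      Finset.sum_range_succ', quot, sub_eq_neg_add, ← Finset.sum_neg_distrib]
    congr 1
    · refine Finset.sum_congr rfl fun m _ => ?_
      rw [PowerSeries.coeff_rescale, Nat.add_sub_add_right, zero_add, add_comm 1]
      ring
    · simp [PowerSeries.coeff_rescale, h0]
  constructor
  · intro hA l
    have h' := h l
    rw [hA, PowerSeries.coeff_one, if_neg (Nat.succ_ne_zero l)] at h'
    exact (sub_eq_zero.1 h'.symm).symm
  · intro hA
    ext l
    rcases l with _ | l
    · simp [PowerSeries.coeff_mul, PowerSeries.coeff_rescale, h0]
    · rw [h, hA, sub_self, PowerSeries.coeff_one, if_neg (Nat.succ_ne_zero l)]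

theorem IsSymplectic.quot_zero_left {R : Type*} [CommRing R] {A : PowerSeries R}
    (hA : IsSymplectic A) (l : ℕ) : quot A 0 l = PowerSeries.coeff (l + 1) A :=
  (isSymplectic_iff.1 hA).2 l

/-- The generating series `∑ U_{kl} y^k x^l` of `quot`. -/
noncomputable def quotSeries {R : Type*} [CommRing R] (A : PowerSeries R) :
    PowerSeries (PowerSeries R) :=
  PowerSeries.mk fun k => PowerSeries.mk fun l => quot A k l

theorem coeff_quotSeries {R : Type*} [CommRing R] (A : PowerSeries R) (k l : ℕ) :
    PowerSeries.coeff l (PowerSeries.coeff k (quotSeries A)) = quot A k l := by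
  simp [quotSeries]

theorem IsSymplectic.quotSeries_spec {R : Type*} [CommRing R] {A : PowerSeries R}
    (hA : IsSymplectic A) :
    (PowerSeries.X + PowerSeries.C PowerSeries.X) * quotSeries A =
      PowerSeries.C A * PowerSeries.map PowerSeries.C A - 1 := by
  have h0 := hA.1
  rw [← PowerSeries.coeff_zero_eq_constantCoeff_apply] at h0
  ext k l
  have h1 : PowerSeries.coeff l (PowerSeries.coeff k
      (PowerSeries.C A * PowerSeries.map PowerSeries.C A)) =
      PowerSeries.coeff k A * PowerSeries.coeff l A := by
    rw [PowerSeries.coeff_C_mul, PowerSeries.coeff_map, mul_comm, PowerSeries.coeff_C_mul]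
  rw [add_mul, map_add, map_add, map_sub, map_sub, h1, PowerSeries.coeff_C_mul]
  rcases k with _ | k <;> rcases l with _ | l
  · simp [h0]
  · rw [PowerSeries.coeff_zero_X_mul, PowerSeries.coeff_succ_X_mul, coeff_quotSeries,
      hA.quot_zero_left]
    simp [h0, PowerSeries.coeff_one]
  · rw [PowerSeries.coeff_zero_X_mul, PowerSeries.coeff_succ_X_mul, coeff_quotSeries,
      quot_zero_right]
    simp [PowerSeries.coeff_one]
  · rw [PowerSeries.coeff_succ_X_mul, PowerSeries.coeff_succ_X_mul, coeff_quotSeries,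
      coeff_quotSeries, quot_succ_right]
    simp [PowerSeries.coeff_one]

theorem IsSymplectic.quot_comm {R : Type*} [CommRing R] {A : PowerSeries R}
    (hA : IsSymplectic A) (k l : ℕ) : quot A k l = quot A l k := by
  have h0 := hA.1
  rw [← PowerSeries.coeff_zero_eq_constantCoeff_apply] at h0
  induction l generalizing k with
  | zero => rw [quot_zero_right, hA.quot_zero_left, h0, mul_one]
  | succ l ih =>
    rcases k with _ | k
    · rw [quot_zero_right, hA.quot_zero_left, h0, mul_one]
    · have h := ih (k + 2)
      have h' := ih k
      rw [quot_succ_right, ih, quot_succ_right]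
      ring

theorem quotSeries_unique {U V : PowerSeries (PowerSeries Potential)}
    (h : (PowerSeries.X + PowerSeries.C PowerSeries.X) * U =
      (PowerSeries.X + PowerSeries.C PowerSeries.X) * V) : U = V := by
  rw [← sub_eq_zero, ← mul_sub, mul_eq_zero] at h
  rcases h with h | h
  · have := congrArg (PowerSeries.coeff 1) h
    simp at this
  · exact sub_eq_zero.1 h

/-- Divide `AA'BB' - 1 = AA'(BB' - 1) + (AA' - 1)` by `x + y`, a prime denoting the variable `y`.
The last summand is the source of the form `W` in the action. -/
theorem quotSeries_mul {A B : PowerSeries Potential} (hA : IsSymplectic A) (hB : IsSymplectic B) :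
    quotSeries (A * B) =
      PowerSeries.C A * PowerSeries.map PowerSeries.C A * quotSeries B + quotSeries A := by
  refine quotSeries_unique ?_
  rw [(hA.mul hB).quotSeries_spec, mul_add, mul_left_comm, hA.quotSeries_spec,
    hB.quotSeries_spec, map_mul, map_mul]
  ring

theorem coeffDeriv_map_C_mul (m : ℕ) (J : PowerSeries ℂ) (c : PowerSeries Potential) :
    coeffDeriv m (PowerSeries.map C J * c) = PowerSeries.map C J * coeffDeriv m c := by
  ext1 n
  rw [coeffDeriv, PowerSeries.coeff_mk, PowerSeries.coeff_mul, PowerSeries.coeff_mul, map_sum]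
  refine Finset.sum_congr rfl fun p _ => ?_
  rw [PowerSeries.coeff_map, Derivation.leibniz, pderiv_C, coeffDeriv,
    PowerSeries.coeff_mk]
  simp

theorem coeffDeriv_jet (m : ℕ) (J : PowerSeries ℂ) (v : Potential) :
    coeffDeriv m (jet J v) = PowerSeries.C (pderiv ℂ m v) * (PowerSeries.X * jet J v) := by
  rw [jet, coeffDeriv_map_C_mul, mul_left_comm _ (PowerSeries.map C J),
    mul_left_comm _ (PowerSeries.map C J)]
  congr 1
  ext1 n
  rw [coeffDeriv, PowerSeries.coeff_mk, PowerSeries.coeff_C_mul, PowerSeries.coeff_rescale,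
    coeff_exp_potential, mul_comm, Derivation.leibniz, pderiv_C, smul_zero, add_zero, smul_eq_mul]
  rcases n with _ | n
  · rw [PowerSeries.coeff_zero_X_mul, pow_zero, ← map_one C, pderiv_C]
    simp
  · rw [PowerSeries.coeff_succ_X_mul, PowerSeries.coeff_rescale, coeff_exp_potential, pderiv_pow,
      Nat.add_sub_cancel, Nat.factorial_succ]
    have h : (C ((((n + 1) * n.factorial : ℕ) : ℂ)⁻¹) : Potential) * ((n + 1 : ℕ) : Potential) =
        C ((n.factorial : ℂ)⁻¹) := by
      rw [← map_natCast (C : ℂ →+* Potential), ← map_mul]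
      congr 1
      have := Nat.cast_add_one_ne_zero (R := ℂ) n
      push_cast
      field_simp
    rw [← h]
    ring

/-- Differentiating `A(x) A(y)` in `v` produces the factor `x + y`, which cancels the denominator.
-/
theorem pderiv_quot_jet (m : ℕ) (J : PowerSeries ℂ) (v : Potential) (k l : ℕ)
    (hJ : PowerSeries.coeff 0 J = 1) :
    pderiv ℂ m (quot (jet J v) k l) = pderiv ℂ m v *
      (PowerSeries.coeff k (jet J v) * PowerSeries.coeff l (jet J v)) := by
  have h0 : PowerSeries.coeff 0 (jet J v) = 1 := by rw [coeff_zero_jet, hJ, map_one]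
  have hd (n : ℕ) : pderiv ℂ m (PowerSeries.coeff (n + 1) (jet J v)) =
      pderiv ℂ m v * PowerSeries.coeff n (jet J v) := by
    have h := congrArg (PowerSeries.coeff (n + 1)) (coeffDeriv_jet m J v)
    rwa [coeffDeriv, PowerSeries.coeff_mk, PowerSeries.coeff_C_mul,
      PowerSeries.coeff_succ_X_mul] at h
  induction l generalizing k with
  | zero => rw [quot_zero_right, h0, mul_one, mul_one, hd]
  | succ l ih =>
    rw [quot_succ_right, map_sub, ih, Derivation.leibniz, hd, hd, smul_eq_mul, smul_eq_mul]
    ring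

end FormalGW

/-! ### Solutions of DE, SE and TRR are exactly the represented potentials -/

namespace FormalGW

open MvPowerSeries
open scoped MvPowerSeries.WithPiTopology

theorem pderiv_comm (i j : ℕ) (F : Potential) :
    pderiv ℂ i (pderiv ℂ j F) = pderiv ℂ j (pderiv ℂ i F) := by
  ext d
  simp only [coeff_pderiv, Finsupp.add_apply]
  rw [add_right_comm]
  by_cases h : i = j
  · subst h; ring
  · simp [h, Ne.symm h]
    ring

theorem formalSum_q_mul (g : ℕ → Potential) :
    formalSum (fun i => q i * g i) = ell (PowerSeries.mk g) := by
  have h : (fun i => q i * g i) = fun i => g i * q i := funext fun i => mul_comm _ _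
  rw [h]
  refine (isLocallyFinite_q.mul_left g).formalSum_eq ?_
  simpa using hasSum_ell (PowerSeries.mk g)

theorem formalSum_q_succ_mul (g : ℕ → Potential) :
    formalSum (fun i => q (i + 1) * g i) = ell (PowerSeries.X * PowerSeries.mk g) := by
  have h : (fun i => q (i + 1) * g i) = fun i => g i * q (i + 1) := funext fun i => mul_comm _ _
  rw [h]
  refine ((isLocallyFinite_q.comp_injective Nat.succ_injective).mul_left g).formalSum_eq ?_
  have h2 := hasSum_ell (PowerSeries.X * PowerSeries.mk g)
  rw [← Nat.succ_injective.hasSum_iff] at h2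
  · simpa [Function.comp_def, PowerSeries.coeff_succ_X_mul] using h2
  · rintro (_ | n) hn
    · simp
    · exact absurd ⟨n, rfl⟩ hn

theorem dilatonEq_iff (F : Potential) :
    DilatonEq F ↔ ell (PowerSeries.mk fun i => pderiv ℂ i F) = 2 * F := by
  rw [DilatonEq, formalSum_q_mul]

theorem stringEq_iff (F : Potential) :
    StringEq F ↔ ell (PowerSeries.X * PowerSeries.mk fun i => pderiv ℂ i F) =
      -((1 / 2 : ℂ) • q 0 ^ 2) := by
  rw [StringEq, formalSum_q_succ_mul]

theorem ell_one : ell 1 = q 0 := by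
  refine (hasSum_ell 1).unique ?_
  convert hasSum_single (f := fun n => PowerSeries.coeff n (1 : PowerSeries Potential) * q n) 0 ?_
    using 1
  · simp
  · intro n hn
    simp [PowerSeries.coeff_one, hn]

theorem coeffDeriv_X_mul (m : ℕ) (c : PowerSeries Potential) :
    coeffDeriv m (PowerSeries.X * c) = PowerSeries.X * coeffDeriv m c := by
  ext1 n
  rcases n with _ | n <;> simp [coeffDeriv, PowerSeries.coeff_succ_X_mul]

/-- `F = (1/2) ∑ U_{kl} q_k q_l` where `U` is `(A(x) A(y) - 1) / (x + y)`, `A(x) = J(x) exp(v x)`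
and `∑ A_k q_k = 0`. -/
def Represents (J : PowerSeries ℂ) (v F : Potential) : Prop :=
  ell (jet J v) = 0 ∧ F = (1 / 2 : ℂ) • bil (quotSeries (jet J v))

theorem two_mul_half_smul (F : Potential) : 2 * ((1 / 2 : ℂ) • F) = F := by
  rw [two_mul, ← add_smul]
  norm_num

namespace Represents

variable {J : PowerSeries ℂ} {v F : Potential}

theorem coeff_zero_jet (hJ : IsSymplectic J) : PowerSeries.coeff 0 (jet J v) = 1 := by
  rw [PowerSeries.coeff_zero_eq_constantCoeff_apply, (hJ.jet v).1]

theorem coeff_zero_eq_one (hJ : IsSymplectic J) : PowerSeries.coeff 0 J = 1 := by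
  rw [PowerSeries.coeff_zero_eq_constantCoeff_apply, hJ.1]

/-- Each row of `∂_m U` is a multiple of `A`, and `ell A = 0`. So only the explicit `q`-dependence
of `F` contributes to its derivatives. -/
theorem ell_coeffDeriv (h : Represents J v F) (hJ : IsSymplectic J) (m k : ℕ) :
    ell (coeffDeriv m (PowerSeries.coeff k (quotSeries (jet J v)))) = 0 := by
  have h1 : coeffDeriv m (PowerSeries.coeff k (quotSeries (jet J v))) =
      PowerSeries.C (pderiv ℂ m v * PowerSeries.coeff k (jet J v)) * jet J v := by
    ext1 l
    rw [coeffDeriv, PowerSeries.coeff_mk, coeff_quotSeries,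
      pderiv_quot_jet m J v k l (coeff_zero_eq_one hJ), PowerSeries.coeff_C_mul, mul_assoc]
  rw [h1, ell_C_mul, h.1, mul_zero]

theorem pderiv_eq (h : Represents J v F) (hJ : IsSymplectic J) (m : ℕ) :
    pderiv ℂ m F = ell (PowerSeries.coeff m (quotSeries (jet J v))) := by
  have h1 : coeffDeriv m (PowerSeries.mk fun k =>
      ell (PowerSeries.coeff k (quotSeries (jet J v)))) =
      PowerSeries.coeff m (quotSeries (jet J v)) := by
    ext1 k
    rw [coeffDeriv, PowerSeries.coeff_mk, PowerSeries.coeff_mk, pderiv_ell,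
      h.ell_coeffDeriv hJ, zero_add, coeff_quotSeries, coeff_quotSeries, (hJ.jet v).quot_comm]
  rw [h.2, Derivation.map_smul, bil, pderiv_ell, h1, PowerSeries.coeff_mk, ← two_mul,
    ← mul_smul_comm, two_mul_half_smul]

theorem pderiv_pderiv_eq (h : Represents J v F) (hJ : IsSymplectic J) (m n : ℕ) :
    pderiv ℂ n (pderiv ℂ m F) = quot (jet J v) m n := by
  rw [h.pderiv_eq hJ, pderiv_ell, h.ell_coeffDeriv hJ, zero_add, coeff_quotSeries]

theorem pderiv_v (h : Represents J v F) (hJ : IsSymplectic J) (n : ℕ) :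
    pderiv ℂ n v = PowerSeries.coeff n (jet J v) * pderiv ℂ 0 v := by
  -- The derivative of `ell A = 0`; eliminating `ell (x A)` between `n` and `0` gives the claim.
  have key (n : ℕ) : pderiv ℂ n v * ell (PowerSeries.X * jet J v) +
      PowerSeries.coeff n (jet J v) = 0 := by
    rw [← ell_C_mul, ← coeffDeriv_jet, ← pderiv_ell, h.1, map_zero]
  have h0 := key 0
  rw [coeff_zero_jet hJ] at h0
  linear_combination (pderiv ℂ n v) * h0 - (pderiv ℂ 0 v) * key n

theorem mem_GW0 (h : Represents J v F) (hJ : IsSymplectic J) : F ∈ GW0 := by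
  have h1 : (PowerSeries.mk fun i => pderiv ℂ i F) =
      PowerSeries.mk fun k => ell (PowerSeries.coeff k (quotSeries (jet J v))) := by
    ext1 k
    rw [PowerSeries.coeff_mk, PowerSeries.coeff_mk, h.pderiv_eq hJ]
  refine ⟨?_, ?_, ?_⟩
  · rw [dilatonEq_iff, h1, h.2, two_mul_half_smul, bil]
  · rw [stringEq_iff, h1]
    have h2 : (PowerSeries.X * PowerSeries.mk fun k =>
        ell (PowerSeries.coeff k (quotSeries (jet J v)))) =
        PowerSeries.mk fun k =>
          ell (PowerSeries.coeff k (PowerSeries.X * quotSeries (jet J v))) := by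
      ext1 k
      rcases k with _ | k <;> simp [PowerSeries.coeff_succ_X_mul]
    -- By the symmetry of `U` the forms `xU` and `yU` agree, so each is half of `ell(A)² - ell(1)² =
    -- -q_0²`.
    have h3 : bil (PowerSeries.C PowerSeries.X * quotSeries (jet J v)) =
        bil (PowerSeries.X * quotSeries (jet J v)) := by
      refine bil_swap _ _ fun k l => ?_
      rw [PowerSeries.coeff_C_mul]
      rcases l with _ | l
      · simp
      · rw [PowerSeries.coeff_succ_X_mul, PowerSeries.coeff_succ_X_mul, coeff_quotSeries,
          coeff_quotSeries, (hJ.jet v).quot_comm]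
    have h4 := congrArg bil (eq_sub_iff_add_eq.1 (hJ.jet v).quotSeries_spec)
    have h5 : (1 : PowerSeries (PowerSeries Potential)) =
        PowerSeries.C 1 * PowerSeries.map PowerSeries.C 1 := by simp
    rw [bil_add, add_mul, bil_add, h3, bil_C_mul_map_C, h.1, h5, bil_C_mul_map_C, ell_one,
      ← two_mul] at h4
    rw [h2, ← bil]
    rw [← smul_neg, ← two_mul_half_smul (bil _), mul_smul_comm]
    congr 1
    linear_combination h4
  · intro k l m
    rw [h.pderiv_pderiv_eq hJ, h.pderiv_pderiv_eq hJ,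
      pderiv_quot_jet _ J v _ _ (coeff_zero_eq_one hJ),
      pderiv_quot_jet _ J v _ _ (coeff_zero_eq_one hJ), h.pderiv_v hJ (k + 1),
      (hJ.jet v).quot_zero_left]
    ring

theorem coeff_succ_jet (h : Represents J v F) (hJ : IsSymplectic J) (k : ℕ) :
    PowerSeries.coeff (k + 1) (jet J v) = pderiv ℂ k (pderiv ℂ 0 F) := by
  rw [h.pderiv_pderiv_eq hJ, (hJ.jet v).quot_zero_left]

end Represents

theorem map_constantCoeff_jet (J : PowerSeries ℂ) (v : Potential) :
    PowerSeries.map constantCoeff (jet J v) =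
      J * PowerSeries.rescale (constantCoeff v) (PowerSeries.exp ℂ) := by
  rw [jet, map_mul]
  have h1 : PowerSeries.map constantCoeff (PowerSeries.map (C : ℂ →+* Potential) J) = J := by
    ext1 n
    simp
  have h2 : PowerSeries.map constantCoeff (PowerSeries.rescale v (PowerSeries.exp Potential)) =
      PowerSeries.rescale (constantCoeff v) (PowerSeries.exp ℂ) := by
    ext1 n
    rw [PowerSeries.coeff_map, PowerSeries.coeff_rescale, coeff_exp_potential,
      PowerSeries.coeff_rescale, PowerSeries.coeff_exp]
    simp
  rw [h1, h2]

theorem exists_represents {F : Potential} (hF : F ∈ GW0) :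
    ∃ J v, IsSymplectic J ∧ Represents J v F := by
  obtain ⟨hD, hS, hT⟩ := hF
  rw [dilatonEq_iff] at hD
  rw [stringEq_iff] at hS
  set g : PowerSeries Potential := PowerSeries.mk fun i => pderiv ℂ i F with hg
  set Ω : ℕ → ℕ → Potential := fun k l => pderiv ℂ k (pderiv ℂ l F) with hΩ
  have Ω_comm (k l : ℕ) : Ω k l = Ω l k := pderiv_comm _ _ _
  -- The candidate for `A`, dictated by `U_{0,k} = A_{k+1}`.
  set R : PowerSeries Potential := 1 + PowerSeries.X * PowerSeries.mk (Ω 0) with hR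
  have R0 : PowerSeries.coeff 0 R = 1 := by simp [hR]
  have RS (k : ℕ) : PowerSeries.coeff (k + 1) R = Ω 0 k := by
    simp [hR, PowerSeries.coeff_succ_X_mul, PowerSeries.coeff_one]
  have gD (l : ℕ) : coeffDeriv l g = PowerSeries.mk (Ω l) := by
    ext1 i
    simp [coeffDeriv, hg, hΩ]
  have trr (i l m : ℕ) : pderiv ℂ i (Ω l m) = PowerSeries.coeff i R * pderiv ℂ 0 (Ω l m) := by
    rcases i with _ | i
    · rw [R0, one_mul]
    · rw [RS, Ω_comm 0 i]
      exact hT i l m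
  have gell (l : ℕ) : ell (PowerSeries.mk (Ω l)) = pderiv ℂ l F := by
    have h := congrArg (pderiv ℂ l) hD
    rw [pderiv_ell, gD, two_mul, map_add, hg, PowerSeries.coeff_mk] at h
    exact add_right_cancel h
  have str (l : ℕ) : ell (PowerSeries.X * PowerSeries.mk (Ω l)) +
      PowerSeries.coeff l (PowerSeries.X * g) = - if 0 = l then q 0 else 0 := by
    have h := congrArg (pderiv ℂ l) hS
    rw [pderiv_ell, coeffDeriv_X_mul, gD] at h
    rw [h, map_neg, Derivation.map_smul, pderiv_pow, pderiv_q]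
    split_ifs
    · have h2 := two_mul_half_smul (q 0)
      rw [mul_smul_comm] at h2
      simpa using h2
    · simp
  -- The `t_0`-derivative of the string equation.
  have hell : ell R = 0 := by
    have h := str 0
    rw [if_pos rfl, PowerSeries.coeff_zero_X_mul, add_zero] at h
    rw [hR, map_add, ell_one, h, add_neg_cancel]
  have str2 (l m : ℕ) : ell (PowerSeries.X * R) * pderiv ℂ 0 (Ω l m) +
      PowerSeries.coeff m (PowerSeries.X * PowerSeries.mk (Ω l)) +
      PowerSeries.coeff l (PowerSeries.X * PowerSeries.mk (Ω m)) =
        - if 0 = l ∧ 0 = m then 1 else 0 := by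
    have h := congrArg (pderiv ℂ m) (str l)
    have h1 : coeffDeriv m (PowerSeries.mk (Ω l)) =
        PowerSeries.C (pderiv ℂ 0 (Ω l m)) * R := by
      ext1 i
      rw [coeffDeriv, PowerSeries.coeff_mk, PowerSeries.coeff_mk, PowerSeries.coeff_C_mul,
        mul_comm, ← trr, Ω_comm l i]
      simp only [hΩ]
      rw [pderiv_comm m i, pderiv_comm m l]
    have h2 : pderiv ℂ m (PowerSeries.coeff l (PowerSeries.X * g)) =
        PowerSeries.coeff l (PowerSeries.X * PowerSeries.mk (Ω m)) := by
      rw [← gD, ← coeffDeriv_X_mul, coeffDeriv, PowerSeries.coeff_mk]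
    rw [map_add, pderiv_ell, coeffDeriv_X_mul, h1, h2, mul_left_comm, ell_C_mul, map_neg] at h
    rw [mul_comm (ell _), h]
    congr 1
    by_cases hl : 0 = l
    · simp [hl.symm, pderiv_q]
    · simp [hl]
  have T (l m : ℕ) : pderiv ℂ 0 (Ω l m) =
      PowerSeries.coeff l R * PowerSeries.coeff m R * pderiv ℂ 0 (Ω 0 0) := by
    have h1 : pderiv ℂ 0 (Ω l m) = pderiv ℂ l (Ω m 0) := by
      simp only [hΩ]
      rw [pderiv_comm 0 l, pderiv_comm 0 m]
    have h2 : pderiv ℂ 0 (Ω m 0) = pderiv ℂ m (Ω 0 0) := by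
      simp only [hΩ]
      rw [pderiv_comm 0 m]
    rw [h1, trr, h2, trr, mul_assoc]
  have E : ell (PowerSeries.X * R) * pderiv ℂ 0 (Ω 0 0) = -1 := by
    simpa using str2 0 0
  -- The second derivatives of the string equation, with the factor `ell (x R) ∂_0 v = -1`
  -- eliminated by TRR, say that `(x + y) Ω = R(x) R(y) - 1`.
  have recur (l m : ℕ) : PowerSeries.coeff m (PowerSeries.X * PowerSeries.mk (Ω l)) +
      PowerSeries.coeff l (PowerSeries.X * PowerSeries.mk (Ω m)) =
        PowerSeries.coeff l R * PowerSeries.coeff m R - if 0 = l ∧ 0 = m then 1 else 0 := by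
    have h := str2 l m
    rw [T] at h
    linear_combination h - PowerSeries.coeff l R * PowerSeries.coeff m R * E
  have hquot (k l : ℕ) : Ω k l = quot R k l := by
    induction l generalizing k with
    | zero => rw [quot_zero_right, R0, mul_one, RS, Ω_comm]
    | succ l ih =>
      have h := recur (k + 1) (l + 1)
      rw [PowerSeries.coeff_succ_X_mul, PowerSeries.coeff_succ_X_mul, PowerSeries.coeff_mk,
        PowerSeries.coeff_mk, if_neg (by simp), sub_zero, ih, Ω_comm (l + 1)] at h
      rw [quot_succ_right, ← h]
      ring
  have hsymp : IsSymplectic R := isSymplectic_iff.2 ⟨R0, fun l => by rw [← hquot, RS]⟩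
  set v := Ω 0 0 with hv
  -- At `t = 0` only `q_1 = -1` survives, so `ell R` becomes `-R_1 = -v`.
  have hv0 : constantCoeff v = 0 := by
    have h := congrArg (coeff 0) hell
    rw [coeff_ell] at h
    simpa [RS] using h
  -- Both sides agree at `t = 0` and satisfy `∂_m A_{k+1} = (∂_m v) A_k`, so induction on `k`
  -- identifies them.
  have hjet : R = jet (PowerSeries.map constantCoeff R) v := by
    have hc := map_constantCoeff_jet (PowerSeries.map constantCoeff R) v
    rw [hv0, PowerSeries.rescale_zero] at hc
    ext1 k
    have hck := congrArg (PowerSeries.coeff k) hc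
    simp only [PowerSeries.coeff_map, RingHom.comp_apply, PowerSeries.constantCoeff_exp, map_one,
      mul_one] at hck
    induction k with
    | zero => rw [coeff_zero_jet, PowerSeries.coeff_map, R0, map_one, map_one]
    | succ k ih =>
      refine pderiv.ext (fun m => ?_) hck.symm
      have h1 := congrArg (PowerSeries.coeff (k + 1))
        (coeffDeriv_jet m (PowerSeries.map constantCoeff R) v)
      rw [coeffDeriv, PowerSeries.coeff_mk, PowerSeries.coeff_C_mul,
        PowerSeries.coeff_succ_X_mul, ← ih] at h1
      · rw [h1, RS, mul_comm]
        have h2 : pderiv ℂ m (Ω 0 k) = pderiv ℂ k (Ω m 0) := by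
          simp only [hΩ]
          rw [pderiv_comm 0 k, pderiv_comm m k]
        have h3 : pderiv ℂ 0 (Ω m 0) = pderiv ℂ m v := by
          simp only [hΩ, hv]
          rw [pderiv_comm 0 m]
        rw [h2, trr, h3]
      · have := congrArg (PowerSeries.coeff k) hc
        simpa only [PowerSeries.coeff_map, RingHom.comp_apply, PowerSeries.constantCoeff_exp,
          map_one, mul_one] using this
  refine ⟨PowerSeries.map constantCoeff R, v, hsymp.map _, ?_⟩
  rw [Represents, ← hjet]
  refine ⟨hell, ?_⟩
  have h1 : bil (quotSeries R) = 2 * F := by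
    rw [← hD, bil]
    congr 1
    ext1 k
    rw [PowerSeries.coeff_mk, hg, PowerSeries.coeff_mk, ← gell]
    congr 1
    ext1 l
    rw [coeff_quotSeries, PowerSeries.coeff_mk, hquot]
  rw [h1, ← mul_smul_comm, two_mul_half_smul]

end FormalGW

/-! ### Solving `ell (J exp(v x)) = 0` for `v` -/

namespace FormalGW

open MvPowerSeries
open scoped MvPowerSeries.WithPiTopology

/-- The power series without terms of total degree less than `N`. -/
def degreeIdeal (N : ℕ) : Ideal Potential where
  carrier := {F | ∀ d : ℕ →₀ ℕ, d.degree < N → coeff d F = 0}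
  zero_mem' d _ := map_zero _
  add_mem' ha hb d hd := by rw [map_add, ha d hd, hb d hd, add_zero]
  smul_mem' c F hF d hd := by
    classical
    rw [smul_eq_mul, coeff_mul]
    refine Finset.sum_eq_zero fun p hp => ?_
    rw [hF p.2, mul_zero]
    rw [← Finset.HasAntidiagonal.mem_antidiagonal.1 hp, map_add] at hd
    omega

theorem degreeIdeal_antitone {M N : ℕ} (h : M ≤ N) : degreeIdeal N ≤ degreeIdeal M :=
  fun _ hF d hd => hF d (hd.trans_le h)

theorem eq_zero_of_forall_mem_degreeIdeal {F : Potential} (h : ∀ N, F ∈ degreeIdeal N) : F = 0 := by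
  ext d
  exact h (d.degree + 1) d (Nat.lt_succ_self _)

theorem sub_dvd_coeff_jet_sub (J : PowerSeries ℂ) (u v : Potential) (n : ℕ) :
    u - v ∣ PowerSeries.coeff n (jet J u) - PowerSeries.coeff n (jet J v) := by
  rw [coeff_jet, coeff_jet, ← Finset.sum_sub_distrib]
  refine Finset.dvd_sum fun p _ => ?_
  rw [← mul_sub]
  exact (sub_dvd_pow_sub_pow u v p.2).mul_left _

theorem degree_sub_single {d : ℕ →₀ ℕ} {n : ℕ} (hn : n ∈ d.support) :
    (d - Finsupp.single n 1).degree + 1 = d.degree := by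
  have h : d - Finsupp.single n 1 + Finsupp.single n 1 = d :=
    tsub_add_cancel_of_le (by simpa [Nat.one_le_iff_ne_zero] using hn)
  conv_rhs => rw [← h, map_add, Finsupp.degree_single]

theorem coeff_add_ell_jet {J : PowerSeries ℂ} (hJ : PowerSeries.coeff 0 J = 1) (v : Potential)
    (d : ℕ →₀ ℕ) : coeff d (v + ell (jet J v)) =
      ∑ n ∈ d.support, coeff (d - Finsupp.single n 1) (PowerSeries.coeff n (jet J v)) -
        coeff d (C (PowerSeries.coeff 1 J)) := by
  rw [map_add, coeff_ell, coeff_one_jet, hJ, map_one, one_mul, map_add]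
  ring

/-- In `v + ell A` the summand `v` cancels against the `-A_1 = -(J_1 + v)` coming from `q_1 = t_1 -
1`. Every other term carries a factor `t_n`, which gains one degree. -/
theorem ell_jet_contraction {J : PowerSeries ℂ} (hJ : PowerSeries.coeff 0 J = 1) {u v : Potential}
    {N : ℕ} (h : u - v ∈ degreeIdeal N) :
    (u + ell (jet J u)) - (v + ell (jet J v)) ∈ degreeIdeal (N + 1) := by
  intro d hd
  rw [map_sub, coeff_add_ell_jet hJ, coeff_add_ell_jet hJ, sub_sub_sub_cancel_right,
    ← Finset.sum_sub_distrib]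
  refine Finset.sum_eq_zero fun n hn => ?_
  rw [← map_sub]
  refine (degreeIdeal N).mem_of_dvd (sub_dvd_coeff_jet_sub J u v n) h _ ?_
  have := degree_sub_single hn
  omega

theorem ell_jet_unique {J : PowerSeries ℂ} (hJ : PowerSeries.coeff 0 J = 1) {u v : Potential}
    (hu : ell (jet J u) = 0) (hv : ell (jet J v) = 0) : u = v := by
  refine sub_eq_zero.1 (eq_zero_of_forall_mem_degreeIdeal fun N => ?_)
  induction N with
  | zero => exact fun d hd => absurd hd (Nat.not_lt_zero _)
  | succ N ih =>
    have := ell_jet_contraction hJ ih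
    rwa [hu, hv, add_zero, add_zero] at this

theorem exists_ell_jet_eq_zero {J : PowerSeries ℂ} (hJ : PowerSeries.coeff 0 J = 1) :
    ∃ v, ell (jet J v) = 0 := by
  set T : Potential → Potential := fun v => v + ell (jet J v) with hT
  set s : ℕ → Potential := fun n => T^[n] 0 with hs
  have s_succ (n : ℕ) : s (n + 1) = T (s n) := Function.iterate_succ_apply' T n 0
  have step (n : ℕ) : s (n + 1) - s n ∈ degreeIdeal n := by
    induction n with
    | zero => exact fun d hd => absurd hd (Nat.not_lt_zero _)
    | succ n ih =>
      have := ell_jet_contraction hJ ih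
      rwa [s_succ (n + 1), s_succ n] at *
  have cauchy (m k : ℕ) : s (m + k) - s m ∈ degreeIdeal m := by
    induction k with
    | zero => simp
    | succ k ih =>
      have := (degreeIdeal m).add_mem
        (degreeIdeal_antitone (Nat.le_add_right m k) (step (m + k))) ih
      rwa [sub_add_sub_cancel] at this
  -- From the iterate of index `d.degree + 1` on, the coefficient at `d` is stationary.
  set v : Potential := fun d => coeff d (s (d.degree + 1)) with hv
  have hlim (n : ℕ) : v - s n ∈ degreeIdeal n := by
    intro d hd
    obtain ⟨k, rfl⟩ := Nat.exists_eq_add_of_le (Nat.succ_le_of_lt hd)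
    have := cauchy (d.degree + 1) k d (Nat.lt_succ_self _)
    rw [map_sub, sub_eq_zero] at this
    rw [map_sub, sub_eq_zero]
    exact this.symm
  refine ⟨v, eq_zero_of_forall_mem_degreeIdeal fun N => ?_⟩
  have h1 : T v - s (N + 1) ∈ degreeIdeal (N + 1) := by
    rw [s_succ]
    exact ell_jet_contraction hJ (hlim N)
  have h2 := (degreeIdeal (N + 1)).sub_mem h1 (hlim (N + 1))
  rw [sub_sub_sub_cancel_right, hT, add_sub_cancel_left] at h2
  exact degreeIdeal_antitone N.le_succ h2

/-! ### Weights of the monomials of `v` and `F` -/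

/-- The grading of monomials for which `t_i` has weight `1 - i`. -/
noncomputable def defect : (ℕ →₀ ℕ) →+ ℤ :=
  Finsupp.weight fun i : ℕ => (1 - i : ℤ)

theorem defect_single (i : ℕ) : defect (Finsupp.single i 1) = 1 - i := by
  simp [defect, Finsupp.weight_single]

/-- The weights of the terms of `F` of degree less than `N` are related to `K` by `r`. -/
def HasDefect (r : AddSubmonoid (ℤ × ℤ)) (N : ℕ) (K : ℤ) (F : Potential) : Prop :=
  ∀ d : ℕ →₀ ℕ, d.degree < N → coeff d F ≠ 0 → (defect d, K) ∈ r

section HasDefect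

variable {r : AddSubmonoid (ℤ × ℤ)} {N : ℕ} {K L : ℤ} {F G : Potential}

theorem HasDefect.of_hasSum {ι : Type*} {f : ι → Potential} (h : HasSum f F)
    (hf : ∀ i, HasDefect r N K (f i)) : HasDefect r N K F := by
  intro d hd hF
  by_contra hr
  refine hF ?_
  have h0 : ∀ i, coeff d (f i) = 0 := fun i => by
    by_contra h'
    exact hr (hf i d hd h')
  have := WithPiTopology.hasSum_iff_hasSum_coeff.1 h d
  simp only [h0] at this
  exact this.unique hasSum_zero

theorem HasDefect.sum {ι : Type*} {s : Finset ι} {f : ι → Potential}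
    (hf : ∀ i ∈ s, HasDefect r N K (f i)) : HasDefect r N K (∑ i ∈ s, f i) := by
  intro d hd hF
  rw [map_sum] at hF
  obtain ⟨i, hi, h⟩ := Finset.exists_ne_zero_of_sum_ne_zero hF
  exact hf i hi d hd h

theorem HasDefect.sub (hF : HasDefect r N K F) (hG : HasDefect r N K G) :
    HasDefect r N K (F - G) := by
  intro d hd h
  by_cases h1 : coeff d F = 0
  · refine hG d hd fun h2 => h ?_
    rw [map_sub, h1, h2, sub_zero]
  · exact hF d hd h1

theorem HasDefect.mul (hF : HasDefect r N K F) (hG : HasDefect r N L G) :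
    HasDefect r N (K + L) (F * G) := by
  classical
  intro d hd h
  rw [coeff_mul] at h
  obtain ⟨p, hp, h⟩ := Finset.exists_ne_zero_of_sum_ne_zero h
  rw [← Finset.HasAntidiagonal.mem_antidiagonal.1 hp, map_add] at hd
  have h1 := hF p.1 (by omega) (left_ne_zero_of_mul h)
  have h2 := hG p.2 (by omega) (right_ne_zero_of_mul h)
  rw [← Finset.HasAntidiagonal.mem_antidiagonal.1 hp, map_add]
  exact r.add_mem h1 h2

theorem hasDefect_C {a : ℂ} (h : a ≠ 0 → (0, K) ∈ r) : HasDefect r N K (C a) := by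
  classical
  intro d _ hd
  rw [coeff_C] at hd
  split_ifs at hd with h0
  · rw [h0, map_zero]
    exact h hd
  · exact absurd rfl hd

theorem hasDefect_one : HasDefect r N 0 1 := by
  rw [← map_one C]
  exact hasDefect_C fun _ => r.zero_mem

theorem HasDefect.pow (hF : HasDefect r N K F) (n : ℕ) : HasDefect r N (n * K) (F ^ n) := by
  induction n with
  | zero => simpa using hasDefect_one
  | succ n ih =>
    have := ih.mul hF
    rw [pow_succ]
    convert this using 1
    push_cast
    ring

theorem HasDefect.C_mul (hF : HasDefect r N K F) (a : ℂ) : HasDefect r N K (C a * F) := by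
  simpa using (hasDefect_C (K := 0) (a := a) fun _ => r.zero_mem).mul hF

theorem hasDefect_q (hr : ∀ a, (a, a) ∈ r) (n : ℕ) : HasDefect r N (1 - n) (q n) := by
  classical
  refine HasDefect.sub (fun d _ hd => ?_) ?_
  · rw [coeff_X] at hd
    split_ifs at hd with h
    · rw [h, defect_single]
      exact hr _
    · exact absurd rfl hd
  · unfold shift
    split_ifs with h
    · rw [h]
      simpa using hasDefect_one
    · exact fun d _ h => absurd (map_zero _) h

theorem hasDefect_coeff_jet {J : PowerSeries ℂ} {v : Potential}
    (hJ : ∀ i : ℕ, PowerSeries.coeff i J ≠ 0 → ((0 : ℤ), (i : ℤ)) ∈ r)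
    (hv : HasDefect r N 1 v) (n : ℕ) : HasDefect r N n (PowerSeries.coeff n (jet J v)) := by
  rw [coeff_jet]
  refine HasDefect.sum fun p hp => ?_
  rw [← Finset.HasAntidiagonal.mem_antidiagonal.1 hp, Nat.cast_add]
  refine HasDefect.mul (hasDefect_C fun h => hJ _ (left_ne_zero_of_mul h)) ?_
  simpa using hv.pow p.2

/-- The coefficient of `v` at a nonzero `d` comes from coefficients of `A_n` at `d` with one `t_n`
removed, so the bound `N` on the degree allows induction. A nonzero `J_i` is a constant of weight
`0` in a place of nominal weight `i`: harmless when `r` is `≤`, and possible only for `i = 0` when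
`r` is equality. -/
theorem hasDefect_of_ell_jet (hr : ∀ a, (a, a) ∈ r) {J : PowerSeries ℂ} {v : Potential}
    (hJ : ∀ i : ℕ, PowerSeries.coeff i J ≠ 0 → ((0 : ℤ), (i : ℤ)) ∈ r)
    (hJ0 : PowerSeries.coeff 0 J = 1) (hv : ell (jet J v) = 0) (N : ℕ) : HasDefect r N 1 v := by
  classical
  induction N with
  | zero => exact fun d hd => absurd hd (Nat.not_lt_zero _)
  | succ N ih =>
    intro d hd h
    have h1 := coeff_add_ell_jet hJ0 v d
    rw [hv, add_zero] at h1
    by_cases hd0 : d = 0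
    · subst hd0
      simp only [Finsupp.support_zero, Finset.sum_empty, zero_sub, coeff_zero_C] at h1
      rw [map_zero]
      refine hJ 1 fun h2 => h ?_
      rw [h1, h2, neg_zero]
    · rw [coeff_C, if_neg hd0, sub_zero] at h1
      rw [h1] at h
      obtain ⟨n, hn, h⟩ := Finset.exists_ne_zero_of_sum_ne_zero h
      have h2 := hasDefect_coeff_jet hJ ih n _ (by have := degree_sub_single hn; omega) h
      have h3 := r.add_mem h2 (hr (1 - n))
      have h4 : d - Finsupp.single n 1 + Finsupp.single n 1 = d :=
        tsub_add_cancel_of_le (by simpa [Nat.one_le_iff_ne_zero] using hn)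
      rw [← defect_single, Prod.mk_add_mk, ← map_add, h4, defect_single] at h3
      simpa using h3

theorem hasDefect_quot_jet {J : PowerSeries ℂ} {v : Potential}
    (hJ : ∀ i : ℕ, PowerSeries.coeff i J ≠ 0 → ((0 : ℤ), (i : ℤ)) ∈ r)
    (hv : HasDefect r N 1 v) (k l : ℕ) : HasDefect r N (k + l + 1) (quot (jet J v) k l) := by
  rw [quot]
  refine HasDefect.sum fun m hm => ?_
  have h := (hasDefect_coeff_jet hJ hv (k + 1 + m)).mul (hasDefect_coeff_jet hJ hv (l - m))
  have h1 : ((-1 : Potential)) ^ m = C ((-1) ^ m) := by simp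
  rw [h1, mul_assoc]
  have hm' := Finset.mem_range.1 hm
  have h2 : ((k + 1 + m : ℕ) : ℤ) + ((l - m : ℕ) : ℤ) = k + l + 1 := by omega
  rw [h2] at h
  exact h.C_mul _

theorem hasDefect_quot_mul_q (hr : ∀ a, (a, a) ∈ r) {J : PowerSeries ℂ} {v : Potential}
    (hJ : ∀ i : ℕ, PowerSeries.coeff i J ≠ 0 → ((0 : ℤ), (i : ℤ)) ∈ r)
    (hv : HasDefect r N 1 v) (k l : ℕ) :
    HasDefect r N 3 (quot (jet J v) k l * (q k * q l)) := by
  convert (hasDefect_quot_jet hJ hv k l).mul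
    ((hasDefect_q (N := N) hr k).mul (hasDefect_q (N := N) hr l)) using 1
  ring

theorem Represents.hasDefect (hr : ∀ a, (a, a) ∈ r) {J : PowerSeries ℂ} {v : Potential}
    (h : Represents J v F)
    (hJ : ∀ i : ℕ, PowerSeries.coeff i J ≠ 0 → ((0 : ℤ), (i : ℤ)) ∈ r)
    (hJ0 : PowerSeries.coeff 0 J = 1) (N : ℕ) : HasDefect r N 3 F := by
  have hv := hasDefect_of_ell_jet hr hJ hJ0 h.1 N
  rw [h.2, smul_eq_C_mul]
  refine HasDefect.C_mul (HasDefect.of_hasSum (hasSum_bil _) fun p => ?_) _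
  rw [coeff_quotSeries]
  exact hasDefect_quot_mul_q hr hJ hv p.1 p.2

end HasDefect

end FormalGW

/-! ### Convergence of the substitution and its effect on `J` -/

namespace FormalGW

open MvPowerSeries
open scoped MvPowerSeries.WithPiTopology

/-- The submonoid of pairs `(a, b)` with `a ≤ b`. -/
def leSubmonoid : AddSubmonoid (ℤ × ℤ) where
  carrier := {p | p.1 ≤ p.2}
  zero_mem' := le_refl (0 : ℤ)
  add_mem' {a b} (ha : a.1 ≤ a.2) (hb : b.1 ≤ b.2) := (add_le_add ha hb : a.1 + b.1 ≤ a.2 + b.2)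

/-- The power series all of whose terms have weight at most `K`. -/
def Tame (K : ℤ) (F : Potential) : Prop :=
  ∀ N, HasDefect leSubmonoid N K F

section Tame

variable {K L : ℤ} {F G : Potential}

theorem tame_iff : Tame K F ↔ ∀ d, coeff d F ≠ 0 → defect d ≤ K :=
  ⟨fun h d hd => h (d.degree + 1) d (Nat.lt_succ_self _) hd, fun h _ d _ hd => h d hd⟩

theorem Tame.mono (h : Tame K F) (hKL : K ≤ L) : Tame L F :=
  tame_iff.2 fun d hd => (tame_iff.1 h d hd).trans hKL

theorem Tame.mul (hF : Tame K F) (hG : Tame L G) : Tame (K + L) (F * G) :=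
  fun N => (hF N).mul (hG N)

theorem Tame.pow (hF : Tame K F) (n : ℕ) : Tame (n * K) (F ^ n) :=
  fun N => (hF N).pow n

theorem Tame.C_mul (hF : Tame K F) (a : ℂ) : Tame K (C a * F) :=
  fun N => (hF N).C_mul a

theorem tame_C (a : ℂ) (h : 0 ≤ K) : Tame K (C a) :=
  fun _ => hasDefect_C fun _ => h

theorem tame_q (n : ℕ) : Tame (1 - n) (q n) :=
  fun _ => hasDefect_q (fun a => le_refl a) n

theorem defect_eq (d : ℕ →₀ ℕ) : defect d = d.degree - Finsupp.weight (fun i => i) d := by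
  rw [defect, Finsupp.degree_apply, Finsupp.weight_apply, Finsupp.weight_apply, Finsupp.sum,
    Finsupp.sum]
  push_cast
  rw [← Finset.sum_sub_distrib]
  refine Finset.sum_congr rfl fun i _ => ?_
  simp
  ring

/-- Here `weight` gives `t_i` the weight `i`. It bounds every index in the support except `0`, for
which nothing is needed, and degree is weight plus defect, which bounds the exponents. -/
theorem finite_weight_le_defect_le (w : ℕ) (K : ℤ) :
    {d : ℕ →₀ ℕ | Finsupp.weight (fun i => i) d ≤ w ∧ defect d ≤ K}.Finite := by
  refine (Set.finite_Iic (∑ i ∈ Finset.range (w + 1),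
    Finsupp.single i (w + K.toNat))).subset fun d hd => ?_
  obtain ⟨h1, h2⟩ := hd
  intro i
  rw [Finsupp.finsetSum_apply]
  by_cases hi : d i = 0
  · rw [hi]
    exact Nat.zero_le _
  · have h3 := Finsupp.le_weight_of_ne_zero' (w := fun i : ℕ => i) hi
    have h4 : i ∈ Finset.range (w + 1) := by
      rw [Finset.mem_range]
      exact Nat.lt_succ_of_le (h3.trans h1)
    refine le_trans ?_ (Finset.single_le_sum (fun _ _ => Nat.zero_le _) h4)
    rw [Finsupp.single_eq_same]
    have h5 := Finsupp.le_degree i d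
    rw [defect_eq] at h2
    have h6 := Int.self_le_toNat K
    omega

end Tame

section Substitution

variable {S : PowerSeries ℂ}

theorem coeff_X_pow_mul_map (i n : ℕ) (R : PowerSeries ℂ) :
    PowerSeries.coeff n (PowerSeries.X ^ i * PowerSeries.map (C : ℂ →+* Potential) R) =
      if i ≤ n then C (PowerSeries.coeff (n - i) R) else 0 := by
  rw [PowerSeries.coeff_X_pow_mul', PowerSeries.coeff_map]

theorem isLocallyFinite_q_add :
    IsLocallyFinite fun p : ℕ × ℕ => q (p.1 + p.2) := by
  intro d
  refine Set.Finite.subset (s := ⋃ n ∈ {n | coeff d (q n) ≠ 0},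
    (Finset.HasAntidiagonal.antidiagonal n : Set (ℕ × ℕ)))
    (Set.Finite.biUnion (isLocallyFinite_q d) fun n _ => Finset.finite_toSet _) ?_
  rintro ⟨i, j⟩ h
  simp only [Set.mem_iUnion]
  exact ⟨i + j, h, by simp⟩

theorem hasSum_qNew (S : PowerSeries ℂ) (i : ℕ) :
    HasSum (fun n => C (PowerSeries.coeff n S⁻¹) * q (i + n)) (qNew S i) := by
  simp only [← smul_eq_C_mul]
  exact ((isLocallyFinite_q.comp_injective (add_right_injective i)).smul _).hasSum

theorem qNew_eq_ell (S : PowerSeries ℂ) (i : ℕ) :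
    qNew S i = ell (PowerSeries.X ^ i * PowerSeries.map C S⁻¹) := by
  refine (hasSum_qNew S i).unique ?_
  have h := hasSum_ell (PowerSeries.X ^ i * PowerSeries.map C S⁻¹)
  rw [← (add_right_injective i).hasSum_iff] at h
  · simpa [Function.comp_def, PowerSeries.coeff_X_pow_mul'] using h
  · intro n hn
    rw [coeff_X_pow_mul_map, if_neg, zero_mul]
    intro hin
    exact hn ⟨n - i, by simp [hin]⟩

/-- Summing along antidiagonals shows that the change of coordinates is adjoint to multiplication by
`S⁻¹`. -/
theorem hasSum_qNew_mul (S : PowerSeries ℂ) (c : PowerSeries Potential) :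
    HasSum (fun n => PowerSeries.coeff n c * qNew S n) (ell (PowerSeries.map C S⁻¹ * c)) := by
  have h := (isLocallyFinite_q_add.mul_left fun p =>
    PowerSeries.coeff p.1 c * C (PowerSeries.coeff p.2 S⁻¹)).hasSum
  have h1 := h.prod_fiberwise (g := fun k => PowerSeries.coeff k c * qNew S k) fun k => by
    have := (hasSum_qNew S k).mul_left (PowerSeries.coeff k c)
    simpa only [mul_assoc] using this
  rw [← (Finset.HasAntidiagonal.sigmaAntidiagonalEquivProd (A := ℕ)).hasSum_iff] at h
  have h2 := h.sigma (g := fun n => PowerSeries.coeff n (PowerSeries.map C S⁻¹ * c) * q n)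
    fun n => by
      convert hasSum_fintype _ using 1
      rw [Finset.univ_eq_attach, mul_comm (PowerSeries.map _ _), PowerSeries.coeff_mul,
        Finset.sum_mul, ← Finset.sum_attach]
      refine Finset.sum_congr rfl fun p _ => ?_
      change _ = PowerSeries.coeff p.1.1 c * C (PowerSeries.coeff p.1.2 S⁻¹) * q (p.1.1 + p.1.2)
      rw [Finset.HasAntidiagonal.mem_antidiagonal.1 p.2, PowerSeries.coeff_map]
  rw [h2.unique (hasSum_ell _)] at h1
  exact h1

theorem isLocallyFinite_qNew (S : PowerSeries ℂ) : IsLocallyFinite (qNew S) := by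
  intro d
  refine Set.Finite.subset (s := Prod.fst '' {p : ℕ × ℕ | coeff d (q (p.1 + p.2)) ≠ 0})
    ((isLocallyFinite_q_add d).image _) ?_
  intro i hi
  by_contra h
  refine hi ?_
  have h1 := WithPiTopology.hasSum_iff_hasSum_coeff.1 (hasSum_qNew S i) d
  have h2 (n : ℕ) : coeff d (C (PowerSeries.coeff n S⁻¹) * q (i + n)) = 0 := by
    rw [coeff_C_mul]
    by_contra h3
    exact h ⟨(i, n), right_ne_zero_of_mul h3, rfl⟩
  simp only [h2] at h1
  exact h1.unique hasSum_zero

theorem coeff_zero_inv (hS : PowerSeries.constantCoeff S = 1) :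
    PowerSeries.coeff 0 S⁻¹ = 1 := by
  rw [PowerSeries.coeff_zero_eq_constantCoeff_apply, PowerSeries.constantCoeff_inv, hS, inv_one]

/-- Only `q_n` with `n ≥ i` occur in `q'_i`. Their constant part comes from `q_1`: for `i = 1` the
shift cancels it, for `i ≥ 2` it is absent, and for `i = 0` it is allowed. That last constant is why
substitution needs a weight bound on `F`. -/
theorem le_weightedOrder_qNew_add_shift (hS : PowerSeries.constantCoeff S = 1) (i : ℕ) :
    (i : ℕ∞) ≤ (qNew S i + shift i).weightedOrder fun i => i := by
  refine nat_le_weightedOrder _ fun d hd => ?_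
  rw [map_add, qNew_eq_ell, coeff_ell, Finset.sum_eq_zero, zero_sub, neg_add_eq_zero,
    coeff_X_pow_mul_map]
  · unfold shift
    rcases Nat.lt_trichotomy i 1 with h | h | h
    · omega
    · subst h
      simp [coeff_zero_inv hS]
    · rw [if_neg (by omega), if_neg (by omega)]
  · intro n hn
    have h := Finsupp.le_weight_of_ne_zero' (w := fun i : ℕ => i) (Finsupp.mem_support_iff.1 hn)
    rw [coeff_X_pow_mul_map, if_neg (by omega), map_zero]

/-- The monomial `t^d` evaluated at `t'_i = q'_i + δ_{i,1}`. -/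
noncomputable def substMonomial (S : PowerSeries ℂ) (d : ℕ →₀ ℕ) : Potential :=
  d.prod fun i e => (qNew S i + shift i) ^ e

theorem substTerm_eq (F : Potential) (d : ℕ →₀ ℕ) :
    substTerm S F d = C (coeff d F) * substMonomial S d := by
  rw [substTerm, smul_eq_C_mul, substMonomial]

theorem substMonomial_add (d e : ℕ →₀ ℕ) :
    substMonomial S (d + e) = substMonomial S d * substMonomial S e :=
  Finsupp.prod_add_index' (fun _ => pow_zero _) fun _ _ _ => pow_add _ _ _

theorem weight_le_of_coeff_substMonomial (hS : PowerSeries.constantCoeff S = 1)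
    {d m : ℕ →₀ ℕ} (h : coeff m (substMonomial S d) ≠ 0) :
    Finsupp.weight (fun i => i) d ≤ Finsupp.weight (fun i => i) m := by
  by_contra! h1
  refine h (coeff_eq_zero_of_lt_weightedOrder (fun i => i) ?_)
  refine lt_of_lt_of_le (Nat.cast_lt.2 h1) ?_
  rw [substMonomial, Finsupp.prod]
  refine le_trans ?_ (le_weightedOrder_prod _ _ _)
  rw [Finsupp.weight_apply, Finsupp.sum, Nat.cast_sum]
  refine Finset.sum_le_sum fun i _ => ?_
  refine le_trans ?_ (le_weightedOrder_pow _ _)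
  rw [smul_eq_mul, Nat.cast_mul, nsmul_eq_mul]
  gcongr
  exact le_weightedOrder_qNew_add_shift hS i

theorem Tame.isLocallyFinite_substTerm {K : ℤ} {F : Potential} (hF : Tame K F)
    (hS : PowerSeries.constantCoeff S = 1) : IsLocallyFinite (substTerm S F) := by
  intro m
  refine (finite_weight_le_defect_le (Finsupp.weight (fun i => i) m) K).subset fun d hd => ?_
  rw [Set.mem_ofPred_eq, substTerm_eq, coeff_C_mul] at hd
  exact ⟨weight_le_of_coeff_substMonomial hS (right_ne_zero_of_mul hd),
    tame_iff.1 hF d (left_ne_zero_of_mul hd)⟩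

/-- The substitution `F ↦ F([S⁻¹(z) q(z)]_+)`. -/
noncomputable def phi (S : PowerSeries ℂ) (F : Potential) : Potential :=
  formalSum (substTerm S F)

theorem Tame.hasSum_phi {K : ℤ} {F : Potential} (hF : Tame K F)
    (hS : PowerSeries.constantCoeff S = 1) : HasSum (substTerm S F) (phi S F) :=
  (hF.isLocallyFinite_substTerm hS).hasSum

theorem Tame.coeff_phi {K : ℤ} {F : Potential} (hF : Tame K F)
    (hS : PowerSeries.constantCoeff S = 1) (m : ℕ →₀ ℕ) :
    coeff m (phi S F) =
      ∑ d ∈ (finite_weight_le_defect_le (Finsupp.weight (fun i => i) m) K).toFinset,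
        coeff d F * coeff m (substMonomial S d) := by
  refine (WithPiTopology.hasSum_iff_hasSum_coeff.1 (hF.hasSum_phi hS) m).unique ?_
  simp only [substTerm_eq, coeff_C_mul]
  refine hasSum_sum_of_ne_finset_zero fun d hd => ?_
  by_contra h
  refine hd ?_
  rw [Set.Finite.mem_toFinset]
  exact ⟨weight_le_of_coeff_substMonomial hS (right_ne_zero_of_mul h),
    tame_iff.1 hF d (left_ne_zero_of_mul h)⟩

/-- A common bound `K` makes each coefficient of `phi S` a finite linear combination over one fixed
set of monomials, so infinite sums pass through. -/
theorem hasSum_phi_of_tame {ι : Type*} {K : ℤ} {f : ι → Potential} {F : Potential}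
    (hS : PowerSeries.constantCoeff S = 1) (hf : ∀ i, Tame K (f i)) (h : HasSum f F) :
    HasSum (fun i => phi S (f i)) (phi S F) := by
  have hF : Tame K F := fun N => HasDefect.of_hasSum h fun i => hf i N
  rw [WithPiTopology.hasSum_iff_hasSum_coeff] at h ⊢
  intro m
  simp only [(hf _).coeff_phi hS, hF.coeff_phi hS]
  exact hasSum_sum fun d _ => (h d).mul_right _

theorem phi_mul {K L : ℤ} {F G : Potential} (hS : PowerSeries.constantCoeff S = 1)
    (hF : Tame K F) (hG : Tame L G) : phi S (F * G) = phi S F * phi S G := by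
  classical
  have h := ((hF.isLocallyFinite_substTerm hS).mul (hG.isLocallyFinite_substTerm hS)).hasSum
  have h1 := (hF.hasSum_phi hS).summable.tsum_mul_tsum_eq_tsum_sum_antidiagonal
    (hG.hasSum_phi hS).summable h.summable
  rw [(hF.hasSum_phi hS).tsum_eq, (hG.hasSum_phi hS).tsum_eq] at h1
  rw [h1, ← ((hF.mul hG).hasSum_phi hS).tsum_eq]
  congr 1
  funext d
  rw [substTerm_eq, coeff_mul, map_sum, Finset.sum_mul]
  refine Finset.sum_congr rfl fun p hp => ?_
  rw [substTerm_eq, substTerm_eq, ← Finset.HasAntidiagonal.mem_antidiagonal.1 hp,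
    substMonomial_add, map_mul]
  ring

theorem phi_sum {ι : Type*} {s : Finset ι} {K : ℤ} {f : ι → Potential}
    (hS : PowerSeries.constantCoeff S = 1) (hf : ∀ i ∈ s, Tame K (f i)) :
    phi S (∑ i ∈ s, f i) = ∑ i ∈ s, phi S (f i) := by
  ext m
  have h : Tame K (∑ i ∈ s, f i) := fun N => HasDefect.sum fun i hi => hf i hi N
  rw [h.coeff_phi hS, map_sum, Finset.sum_congr rfl fun i hi => (hf i hi).coeff_phi hS m,
    Finset.sum_comm]
  simp only [map_sum, Finset.sum_mul]

theorem phi_C (a : ℂ) (hS : PowerSeries.constantCoeff S = 1) : phi S (C a) = C a := by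
  classical
  refine ((tame_C a le_rfl).hasSum_phi hS).unique ?_
  convert hasSum_single (f := substTerm S (C a)) 0 ?_ using 1
  · simp [substTerm_eq, substMonomial]
  · intro d hd
    rw [substTerm_eq, coeff_C, if_neg hd, map_zero, zero_mul]

theorem phi_q (n : ℕ) (hS : PowerSeries.constantCoeff S = 1) : phi S (q n) = qNew S n := by
  classical
  refine ((tame_q n).hasSum_phi hS).unique ?_
  have h1 : HasSum (fun d => C (coeff d (X n : Potential)) * substMonomial S d)
      (qNew S n + shift n) := by
    convert hasSum_single (f := fun d => C (coeff d (X n : Potential)) * substMonomial S d)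
      (Finsupp.single n 1) ?_ using 1
    · simp [substMonomial]
    · intro d hd
      rw [coeff_X, if_neg hd, map_zero, zero_mul]
  have h2 : HasSum (fun d => C (coeff d (shift n)) * substMonomial S d) (shift n) := by
    have h3 : shift n = C (if n = 1 then 1 else 0) := by
      unfold shift
      split_ifs <;> simp
    rw [h3]
    convert hasSum_single (f := fun d => C (coeff d (C (if n = 1 then (1 : ℂ) else 0))) *
      substMonomial S d) 0 ?_ using 1
    · simp [substMonomial]
    · intro d hd
      rw [coeff_C, if_neg hd, map_zero, zero_mul]
  have h3 := h1.sub h2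
  rw [add_sub_cancel_right] at h3
  have h4 : substTerm S (q n) = fun d => C (coeff d (X n : Potential)) * substMonomial S d -
      C (coeff d (shift n)) * substMonomial S d := by
    funext d
    rw [substTerm_eq, q, map_sub, map_sub, sub_mul]
  rwa [h4]

theorem phi_C_mul {K : ℤ} {F : Potential} (hS : PowerSeries.constantCoeff S = 1)
    (hF : Tame K F) (a : ℂ) : phi S (C a * F) = C a * phi S F := by
  rw [phi_mul hS (tame_C a le_rfl) hF, phi_C a hS]

theorem phi_pow {K : ℤ} {F : Potential} (hS : PowerSeries.constantCoeff S = 1)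
    (hF : Tame K F) (n : ℕ) : phi S (F ^ n) = phi S F ^ n := by
  induction n with
  | zero => rw [pow_zero, pow_zero, ← map_one C, phi_C 1 hS]
  | succ n ih => rw [pow_succ, phi_mul hS (hF.pow n) hF, ih, pow_succ]

theorem phi_coeff_jet {v : Potential} (hS : PowerSeries.constantCoeff S = 1) (hv : Tame 1 v)
    (J : PowerSeries ℂ) (n : ℕ) :
    phi S (PowerSeries.coeff n (jet J v)) = PowerSeries.coeff n (jet J (phi S v)) := by
  rw [coeff_jet, coeff_jet, phi_sum (K := n) hS]
  · refine Finset.sum_congr rfl fun p _ => ?_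
    rw [phi_C_mul hS (hv.pow _), phi_pow hS hv]
  · intro p hp
    refine ((hv.pow p.2).mono ?_).C_mul _
    have := Finset.HasAntidiagonal.mem_antidiagonal.1 hp
    omega

theorem tame_coeff_jet {v : Potential} (hv : Tame 1 v) (J : PowerSeries ℂ) (n : ℕ) :
    Tame n (PowerSeries.coeff n (jet J v)) :=
  fun N => hasDefect_coeff_jet (fun i _ => Int.natCast_nonneg i) (hv N) n

theorem phi_quot_jet {v : Potential} (hS : PowerSeries.constantCoeff S = 1) (hv : Tame 1 v)
    (J : PowerSeries ℂ) (k l : ℕ) :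
    phi S (quot (jet J v) k l) = quot (jet J (phi S v)) k l := by
  have h1 (m : ℕ) : ((-1 : Potential)) ^ m = C ((-1) ^ m) := by simp
  have h2 (m : ℕ) := (tame_coeff_jet hv J (k + 1 + m)).mul (tame_coeff_jet hv J (l - m))
  rw [quot, quot, phi_sum (K := k + l + 1) hS]
  · refine Finset.sum_congr rfl fun m _ => ?_
    rw [h1, mul_assoc, mul_assoc, phi_C_mul hS (h2 m),
      phi_mul hS (tame_coeff_jet hv J _) (tame_coeff_jet hv J _), phi_coeff_jet hS hv,
      phi_coeff_jet hS hv]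
  · intro m hm
    rw [h1, mul_assoc]
    refine ((h2 m).mono ?_).C_mul _
    have := Finset.mem_range.1 hm
    omega

theorem Represents.tame_v {J : PowerSeries ℂ} {v F : Potential} (h : Represents J v F)
    (hJ : IsSymplectic J) : Tame 1 v :=
  fun N => hasDefect_of_ell_jet (fun a => le_refl a) (fun i _ => Int.natCast_nonneg i)
    (Represents.coeff_zero_eq_one hJ) h.1 N

theorem Represents.tame {J : PowerSeries ℂ} {v F : Potential} (h : Represents J v F)
    (hJ : IsSymplectic J) : Tame 3 F :=
  fun N => h.hasDefect (fun a => le_refl a) (fun i _ => Int.natCast_nonneg i)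
    (Represents.coeff_zero_eq_one hJ) N

theorem bil_C_mul_map_C_mul (R : PowerSeries Potential)
    (U : PowerSeries (PowerSeries Potential)) :
    bil (PowerSeries.C R * PowerSeries.map PowerSeries.C R * U) =
      ell (R * PowerSeries.mk fun k => ell (R * PowerSeries.coeff k U)) := by
  rw [bil]
  congr 1
  ext1 k
  rw [PowerSeries.coeff_mk, mul_assoc, PowerSeries.coeff_C_mul, PowerSeries.coeff_mul,
    PowerSeries.coeff_mul, Finset.mul_sum, map_sum]
  refine Finset.sum_congr rfl fun p _ => ?_
  rw [PowerSeries.coeff_map, mul_left_comm, ell_C_mul, PowerSeries.coeff_mk]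

theorem quot_map_inv (S : PowerSeries ℂ) (k l : ℕ) :
    quot (PowerSeries.map (C : ℂ →+* Potential) S⁻¹) k l = C (W S k l) := by
  rw [quot, W, map_sum]
  refine Finset.sum_congr rfl fun m _ => ?_
  simp [PowerSeries.coeff_map]

/-- The action of `S` on the potential attached to `J` is the potential attached to `S⁻¹ J`. -/
theorem Represents.act {J : PowerSeries ℂ} {v F : Potential} (h : Represents J v F)
    (hJ : IsSymplectic J) (hS : PowerSeries.constantCoeff S = 1) (hS' : IsSymplectic S⁻¹) :
    Represents (S⁻¹ * J) (phi S v) (act S F) := by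
  have hv := h.tame_v hJ
  set R : PowerSeries Potential := PowerSeries.map C S⁻¹ with hR
  constructor
  · have h1 := hasSum_ell (jet J v)
    rw [h.1] at h1
    have h2 := hasSum_phi_of_tame (K := 1) hS (fun n => by
      have := (tame_coeff_jet hv J n).mul (tame_q n)
      rwa [add_sub_cancel] at this) h1
    rw [← map_zero C, phi_C 0 hS, map_zero] at h2
    rw [← jet_map_mul]
    refine (hasSum_qNew_mul S (jet J (phi S v))).unique ?_
    convert h2 using 2 with n
    rw [phi_mul hS (tame_coeff_jet hv J n) (tame_q n), phi_coeff_jet hS hv, phi_q n hS]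
  · have hU (k l : ℕ) : Tame (k + l + 1) (quot (jet J v) k l) := fun N =>
      hasDefect_quot_jet (fun i _ => Int.natCast_nonneg i) (hv N) k l
    have hT (p : ℕ × ℕ) : Tame 3 (quot (jet J v) p.1 p.2 * (q p.1 * q p.2)) := fun N =>
      hasDefect_quot_mul_q (fun a => le_refl a) (fun i _ => Int.natCast_nonneg i) (hv N) p.1 p.2
    have h1 := hasSum_bil (quotSeries (jet J v))
    simp only [coeff_quotSeries] at h1
    have h2 := hasSum_phi_of_tame hS hT h1
    have h3 := hasSum_mul_family (isLocallyFinite_qNew S) (quotSeries (jet J (phi S v)))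
      (ell.comp (LinearMap.mulLeft Potential R)) (hasSum_qNew_mul S)
    have h4 : phi S (bil (quotSeries (jet J v))) = bil (PowerSeries.C R *
        PowerSeries.map PowerSeries.C R * quotSeries (jet J (phi S v))) := by
      rw [bil_C_mul_map_C_mul]
      refine HasSum.unique ?_ h3
      convert h2 using 2 with p
      rw [phi_mul hS (hU _ _) ((tame_q _).mul (tame_q _)), phi_mul hS (tame_q _) (tame_q _),
        phi_quot_jet hS hv, phi_q _ hS, phi_q _ hS, coeff_quotSeries]
    have h5 : (formalSum fun p : ℕ × ℕ => W S p.1 p.2 • (q p.1 * q p.2)) = bil (quotSeries R) := by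
      refine ((isLocallyFinite_q.mul isLocallyFinite_q).smul _).formalSum_eq ?_
      have := hasSum_bil (quotSeries R)
      simpa only [coeff_quotSeries, hR, quot_map_inv, ← smul_eq_C_mul] using this
    have hb : Tame 3 (bil (quotSeries (jet J v))) := fun N =>
      HasDefect.of_hasSum h1 fun p => hT p N
    -- The substituted form `S⁻¹(x) S⁻¹(y) U` and the form `W` add up to the quotient for `S⁻¹ A`,
    -- by `quotSeries_mul`.
    rw [FormalGW.act, h5, ← phi, h.2, smul_eq_C_mul, phi_C_mul hS hb, h4, ← smul_eq_C_mul,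
      ← smul_add, ← bil_add, ← jet_map_mul, quotSeries_mul (hS'.map C) (hJ.jet _)]

end Substitution

end FormalGW

/-! ### Elements of `G_-` as exponentials of odd series -/

namespace FormalGW

section OddExponential

open PowerSeries

/-- The quotient `E / G` has derivative zero and constant term `1`. -/
theorem eq_of_derivative_eq_mul {E G B : ℂ⟦X⟧} (hE : d⁄dX ℂ E = E * B) (hG : d⁄dX ℂ G = G * B)
    (hE0 : constantCoeff E = 1) (hG0 : constantCoeff G = 1) : E = G := by
  have hG' : G * G⁻¹ = 1 := PowerSeries.mul_inv_cancel G (by rw [hG0]; exact one_ne_zero)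
  have h : E * G⁻¹ = 1 := by
    refine derivative.ext ?_ ?_
    · rw [Derivation.leibniz, derivative_inv', hE, hG]
      simp only [smul_eq_mul, Derivation.map_one_eq_zero]
      linear_combination (-(E * B * G⁻¹)) * hG'
    · simp [hE0, hG0]
  calc E = E * (G * G⁻¹) := by rw [hG', mul_one]
    _ = E * G⁻¹ * G := by ring
    _ = G := by rw [h, one_mul]

theorem derivative_rescale_eq (c : ℂ) (E : ℂ⟦X⟧) :
    d⁄dX ℂ (rescale c E) = C c * rescale c (d⁄dX ℂ E) := by
  ext n
  rw [coeff_derivative, coeff_rescale, coeff_C_mul, coeff_rescale, coeff_derivative]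
  ring

theorem derivative_rescale_exp (c : ℂ) :
    d⁄dX ℂ (rescale c (exp ℂ)) = rescale c (exp ℂ) * C c := by
  rw [derivative_rescale_eq, derivative_exp, mul_comm]

theorem constantCoeff_rescale_exp (c : ℂ) : constantCoeff (rescale c (exp ℂ)) = 1 :=
  (isSymplectic_rescale_exp c).1

/-- The exponent `∑_{i ≥ 1} a_{2i+1} x^{2i+1}`. -/
noncomputable def oddSeries (a : {n : ℕ // Odd n ∧ 3 ≤ n} → ℂ) : ℂ⟦X⟧ :=
  mk fun n => if h : Odd n ∧ 3 ≤ n then a ⟨n, h⟩ else 0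

theorem hasSubst_oddSeries (a : {n : ℕ // Odd n ∧ 3 ≤ n} → ℂ) : HasSubst (oddSeries a) := by
  refine HasSubst.of_constantCoeff_zero' ?_
  rw [← coeff_zero_eq_constantCoeff_apply, oddSeries, coeff_mk, dif_neg (by simp)]

theorem derivative_oddExp (a : {n : ℕ // Odd n ∧ 3 ≤ n} → ℂ) :
    d⁄dX ℂ (oddExp a) = oddExp a * d⁄dX ℂ (oddSeries a) := by
  rw [oddExp, ← oddSeries, derivative_subst (hasSubst_oddSeries a), derivative_exp]

theorem constantCoeff_oddExp (a : {n : ℕ // Odd n ∧ 3 ≤ n} → ℂ) :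
    constantCoeff (oddExp a) = 1 := by
  have h0 : constantCoeff (oddSeries a) = 0 := by
    rw [← coeff_zero_eq_constantCoeff_apply, oddSeries, coeff_mk, dif_neg (by simp)]
  refine (constantCoeff_subst (hasSubst_oddSeries a) _).trans ?_
  rw [finsum_eq_single _ 0]
  · simp
  · intro n hn
    rw [map_pow]
    change _ • constantCoeff (oddSeries a) ^ n = 0
    rw [h0, zero_pow hn, smul_zero]

theorem isSymplectic_oddExp (a : {n : ℕ // Odd n ∧ 3 ≤ n} → ℂ) : IsSymplectic (oddExp a) := by
  refine ⟨constantCoeff_oddExp a, ?_⟩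
  -- The derivative of an odd exponent is even, so the derivative of `S(-x) S(x)` vanishes.
  have hodd : rescale (-1 : ℂ) (d⁄dX ℂ (oddSeries a)) = d⁄dX ℂ (oddSeries a) := by
    ext n
    rw [coeff_rescale, coeff_derivative, oddSeries, coeff_mk]
    rcases Nat.even_or_odd n with h | h
    · rw [h.neg_one_pow, one_mul]
    · rw [dif_neg]
      · simp
      · rintro ⟨h', _⟩
        exact Nat.not_even_iff_odd.2 h' h.add_one
  refine derivative.ext ?_ ?_
  · rw [Derivation.leibniz, derivative_rescale_eq, derivative_oddExp, map_mul, hodd]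
    simp only [smul_eq_mul, map_neg, map_one, Derivation.map_one_eq_zero]
    ring
  · rw [map_mul, constantCoeff_oddExp, ← coeff_zero_eq_constantCoeff_apply, coeff_rescale,
      coeff_zero_eq_constantCoeff_apply, constantCoeff_oddExp]
    simp

/-- The logarithmic derivatives differ by the constant `c`, which does not meet the coefficients of
index `n - 1 ≥ 2`. -/
theorem oddExp_injective_mod {a b : {n : ℕ // Odd n ∧ 3 ≤ n} → ℂ} {c : ℂ}
    (h : oddExp b = oddExp a * rescale c (exp ℂ)) : a = b := by
  have h1 := congrArg (d⁄dX ℂ) h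
  rw [Derivation.leibniz, derivative_oddExp, derivative_oddExp, derivative_rescale_exp,
    smul_eq_mul, smul_eq_mul] at h1
  have hne : oddExp b ≠ 0 := fun h0 => by
    have := constantCoeff_oddExp b
    rw [h0, map_zero] at this
    exact zero_ne_one this
  have h2 : d⁄dX ℂ (oddSeries b) = d⁄dX ℂ (oddSeries a) + C c := by
    refine mul_left_cancel₀ hne ?_
    rw [h1, h]
    ring
  funext ⟨n, hn⟩
  have h3 := congrArg (coeff (n - 1)) h2
  have hn1 : n - 1 + 1 = n := by omega
  rw [map_add, coeff_derivative, coeff_derivative, hn1, coeff_C, if_neg (by omega), add_zero,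
    oddSeries, oddSeries, coeff_mk, coeff_mk, dif_pos hn, dif_pos hn] at h3
  have hne' : ((n - 1 : ℕ) : ℂ) + 1 ≠ 0 := Nat.cast_add_one_ne_zero _
  exact (mul_right_cancel₀ hne' h3).symm

/-- The logarithmic derivative `D = S'(x) S(-x)` is even, by differentiating `S(-x) S(x) = 1`.
Integrating it gives the odd exponent, whose linear coefficient is `D_0`. -/
theorem IsSymplectic.exists_oddExp {S : ℂ⟦X⟧} (hS : IsSymplectic S) :
    ∃ a c, S = oddExp a * rescale c (exp ℂ) := by
  set T := rescale (-1 : ℂ) S with hT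
  have hTS : T * S = 1 := hS.2
  set D : ℂ⟦X⟧ := d⁄dX ℂ S * T with hD
  have hT' : rescale (-1 : ℂ) T = S := by
    rw [hT, rescale_rescale]
    simp
  have hDeven : rescale (-1 : ℂ) D = D := by
    have h1 := congrArg (d⁄dX ℂ) hTS
    rw [Derivation.leibniz, hT, derivative_rescale_eq, ← hT] at h1
    simp only [smul_eq_mul, map_neg, map_one, Derivation.map_one_eq_zero] at h1
    rw [hD, map_mul, hT']
    linear_combination -h1
  have hSD : d⁄dX ℂ S = S * D := by
    rw [hD]
    linear_combination (-(d⁄dX ℂ S)) * hTS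
  refine ⟨fun n => coeff (n.1 - 1) D / n.1, coeff 0 D,
    eq_of_derivative_eq_mul hSD ?_ hS.1 ?_⟩
  · have hB : d⁄dX ℂ (oddSeries fun n => coeff (n.1 - 1) D / n.1) + C (coeff 0 D) = D := by
      ext n
      rw [map_add, coeff_derivative, oddSeries, coeff_mk, coeff_C]
      rcases Nat.even_or_odd n with h | h
      · by_cases hn : n = 0
        · subst hn
          simp
        · have h3 : Odd (n + 1) ∧ 3 ≤ n + 1 := ⟨h.add_one, by
            obtain ⟨k, rfl⟩ := h
            omega⟩
          rw [dif_pos h3, if_neg hn, add_zero]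
          have := Nat.cast_add_one_ne_zero (R := ℂ) n
          push_cast
          field_simp
      · rw [dif_neg fun h' => Nat.not_even_iff_odd.2 h'.1 h.add_one, zero_mul, zero_add, if_neg
          (by rintro rfl; simp at h)]
        have h4 := congrArg (coeff n) hDeven
        rw [coeff_rescale, h.neg_one_pow] at h4
        linear_combination (1 / 2 : ℂ) * h4
    rw [Derivation.leibniz, derivative_oddExp, derivative_rescale_exp, smul_eq_mul, smul_eq_mul]
    linear_combination (oddExp (fun n => coeff (n.1 - 1) D / n.1) *
      rescale (coeff 0 D) (exp ℂ)) * hB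
  · rw [map_mul, constantCoeff_oddExp, constantCoeff_rescale_exp, one_mul]

end OddExponential

end FormalGW

/-! ### The point potential corresponds to `J = 1` -/

namespace FormalGW

open MvPowerSeries
open scoped MvPowerSeries.WithPiTopology

section PointPotential

/-- The automorphism factor `∏_k (k!)^{d_k} d_k!`. -/
noncomputable def symmetryFactor (d : ℕ →₀ ℕ) : ℂ :=
  d.prod fun k e => (k.factorial : ℂ) ^ e * (e.factorial : ℂ)

theorem symmetryFactor_ne_zero (d : ℕ →₀ ℕ) : symmetryFactor d ≠ 0 :=
  Finset.prod_ne_zero_iff.2 fun k _ => mul_ne_zero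
    (pow_ne_zero _ (Nat.cast_ne_zero.2 k.factorial_ne_zero))
    (Nat.cast_ne_zero.2 (Nat.factorial_ne_zero _))

theorem symmetryFactor_add_single (d : ℕ →₀ ℕ) (k : ℕ) :
    symmetryFactor (d + Finsupp.single k 1) =
      symmetryFactor d * (k.factorial : ℂ) * (d k + 1) := by
  have h0 (i : ℕ) : ((i.factorial : ℂ) ^ 0 * ((0 : ℕ).factorial : ℂ)) = 1 := by simp
  have h1 : (d + Finsupp.single k 1).support ⊆ insert k d.support := by
    intro i hi
    by_cases hik : i = k
    · simp [hik]
    · rw [Finsupp.mem_support_iff, Finsupp.add_apply, Finsupp.single_eq_of_ne hik, add_zero] at hi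
      simp [hi]
  rw [symmetryFactor, symmetryFactor, Finsupp.prod_of_support_subset _ h1 _ fun i _ => h0 i,
    Finsupp.prod_of_support_subset _ (Finset.subset_insert k d.support) _ fun i _ => h0 i,
    ← Finset.mul_prod_erase _ _ (Finset.mem_insert_self k d.support),
    ← Finset.mul_prod_erase _ _ (Finset.mem_insert_self k d.support), Finsupp.add_apply,
    Finsupp.single_eq_same, Nat.factorial_succ, pow_succ]
  have h2 : ∏ i ∈ (insert k d.support).erase k, ((i.factorial : ℂ) ^
      (d + Finsupp.single k 1 : ℕ →₀ ℕ) i *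
      (((d + Finsupp.single k 1 : ℕ →₀ ℕ) i).factorial : ℂ)) =
      ∏ i ∈ (insert k d.support).erase k, ((i.factorial : ℂ) ^ d i * ((d i).factorial : ℂ)) := by
    refine Finset.prod_congr rfl fun i hi => ?_
    rw [Finsupp.add_apply, Finsupp.single_eq_of_ne (Finset.ne_of_mem_erase hi), add_zero]
  rw [h2]
  push_cast
  ring

/-- The number of tuples is the coefficient of `X^d` in `(∑ X_k)^n`, computed once by expanding the
product and once by the multinomial theorem. -/
theorem card_tuples (d : ℕ →₀ ℕ) (n : ℕ) (hn : d.degree = n) :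
    (({p ∈ Fintype.piFinset fun _ : Fin n => d.support |
      ∑ j, Finsupp.single (p j) 1 = d}.card : ℕ) : ℂ) *
        d.prod (fun _ e => (e.factorial : ℂ)) = n.factorial := by
  classical
  have h := MvPolynomial.coeff_linearCombination_X_pow (R := ℂ)
    (∑ k ∈ d.support, Finsupp.single k 1) d n
  rw [if_pos (by rw [← hn, Finsupp.degree_apply]; rfl), map_sum] at h
  simp only [Finsupp.linearCombination_single, one_smul] at h
  have h1 : d.prod (fun i m => (∑ k ∈ d.support, Finsupp.single k (1 : ℂ)) i ^ m) = 1 := by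
    refine Finset.prod_eq_one fun i hi => ?_
    beta_reduce
    rw [Finsupp.finsetSum_apply, Finset.sum_eq_single i, Finsupp.single_eq_same, one_pow]
    · intro j _ hj
      exact Finsupp.single_eq_of_ne hj.symm
    · exact fun h => absurd hi h
  rw [h1, mul_one, ← Fin.prod_const, Finset.prod_univ_sum, MvPolynomial.coeff_sum] at h
  have h2 (p : Fin n → ℕ) : MvPolynomial.coeff d (∏ j, (MvPolynomial.X (p j) :
      MvPolynomial ℕ ℂ)) = if ∑ j, Finsupp.single (p j) 1 = d then 1 else 0 := by
    have h3 : ∏ j, (MvPolynomial.X (p j) : MvPolynomial ℕ ℂ) =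
        MvPolynomial.monomial (∑ j, Finsupp.single (p j) 1) 1 := by
      rw [MvPolynomial.monomial_sum_one]
      rfl
    rw [h3, MvPolynomial.coeff_monomial]
  simp only [h2] at h
  rw [Finset.sum_boole] at h
  rw [h, Finsupp.multinomial_eq, Finsupp.prod, ← hn, Finsupp.degree_apply]
  exact_mod_cast (mul_comm _ _).trans (Nat.multinomial_spec d.support d)

theorem psiIntegral_of_sum {d : ℕ →₀ ℕ} {n : ℕ} (p : Fin n → ℕ)
    (h : ∑ j, Finsupp.single (p j) 1 = d) :
    psiIntegral p = if Finsupp.weight (fun i => i) d + 3 = n then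
      ((n - 3).factorial : ℂ) / d.prod (fun k e => (k.factorial : ℂ) ^ e) else 0 := by
  have h1 : Finsupp.weight (fun i => i) d = ∑ j, p j := by
    rw [← h, map_sum]
    simp [Finsupp.weight_single]
  have h2 : d.prod (fun k e => (k.factorial : ℂ) ^ e) = ∏ j, ((p j).factorial : ℂ) := by
    rw [← h, ← Finsupp.prod_finsetSum_index (fun _ => pow_zero _) fun _ _ _ => pow_add _ _ _]
    refine Finset.prod_congr rfl fun j _ => ?_
    exact (Finsupp.prod_single_index (h := fun (k : ℕ) e => (k.factorial : ℂ) ^ e)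
      (pow_zero _)).trans (pow_one _)
  rw [psiIntegral, h1, h2]

theorem defect_eq_three_iff (d : ℕ →₀ ℕ) :
    defect d = 3 ↔ Finsupp.weight (fun i => i) d + 3 = d.degree := by
  rw [defect_eq]
  omega

theorem coeff_pointPotential (d : ℕ →₀ ℕ) :
    coeff d pointPotential = if defect d = 3 then
      ((Finsupp.weight (fun i => i) d).factorial : ℂ) / symmetryFactor d else 0 := by
  classical
  change (if 3 ≤ d.degree then _ else _) = _
  have h : ∑ᶠ (i : Fin d.degree → ℕ) (_ : ∑ j, Finsupp.single (i j) 1 = d), psiIntegral i =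
      ∑ p ∈ Fintype.piFinset fun _ : Fin d.degree => d.support with
        ∑ j, Finsupp.single (p j) 1 = d, psiIntegral p := by
    rw [← finsum_mem_coe_finset]
    refine finsum_congr fun p => finsum_congr_Prop (propext ?_) fun _ => rfl
    rw [Finset.mem_coe, Finset.mem_filter, Fintype.mem_piFinset]
    refine ⟨fun hp => ⟨fun j => ?_, hp⟩, fun hp => hp.2⟩
    rw [Finsupp.mem_support_iff, ← hp, Finsupp.finsetSum_apply]
    refine (Finset.sum_pos' (fun _ _ => Nat.zero_le _) ⟨j, Finset.mem_univ j, ?_⟩).ne'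
    simp
  rw [h, Finset.sum_congr rfl fun p hp => psiIntegral_of_sum p (Finset.mem_filter.1 hp).2,
    Finset.sum_const, nsmul_eq_mul]
  have hcard := card_tuples d _ rfl
  by_cases hd : defect d = 3
  · rw [if_pos hd]
    rw [defect_eq_three_iff] at hd
    rw [if_pos hd, if_pos (by omega)]
    have h3 : d.degree - 3 = Finsupp.weight (fun i => i) d := by omega
    have h4 : symmetryFactor d = d.prod (fun k e => (k.factorial : ℂ) ^ e) *
        d.prod (fun _ e => (e.factorial : ℂ)) := Finsupp.prod_mul ..
    have h5 := symmetryFactor_ne_zero d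
    rw [h4] at h5
    have h6 := left_ne_zero_of_mul h5
    have h7 := right_ne_zero_of_mul h5
    have h8 : (d.degree.factorial : ℂ) ≠ 0 := Nat.cast_ne_zero.2 (Nat.factorial_ne_zero _)
    rw [h3, h4, ← hcard]
    rw [← hcard] at h8
    have h9 := left_ne_zero_of_mul h8
    field_simp
  · rw [if_neg hd]
    rw [defect_eq_three_iff] at hd
    rw [if_neg hd, mul_zero, mul_zero, ite_self]

/-- The submonoid of pairs `(a, a)`. -/
def diagSubmonoid : AddSubmonoid (ℤ × ℤ) where
  carrier := {p | p.1 = p.2}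
  zero_mem' := rfl
  add_mem' {a b} (ha : a.1 = a.2) (hb : b.1 = b.2) :=
    (congrArg₂ (· + ·) ha hb : a.1 + b.1 = a.2 + b.2)

/-- The coefficients of the string equation. -/
theorem stringEq_iff_coeff (F : Potential) : StringEq F ↔ ∀ d : ℕ →₀ ℕ,
    coeff (d + Finsupp.single 0 1) F * (d 0 + 1) =
      ∑ n ∈ d.support, (if n = 0 then 0 else
        coeff (d - Finsupp.single n 1 + Finsupp.single (n - 1) 1) F *
          ((d - Finsupp.single n 1 : ℕ →₀ ℕ) (n - 1) + 1)) +
        if d = Finsupp.single 0 2 then 1 / 2 else 0 := by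
  classical
  rw [stringEq_iff, MvPowerSeries.ext_iff]
  refine forall_congr' fun d => ?_
  have h0 : q 0 = X 0 := by simp [q, shift]
  have h1 : coeff d (-((1 / 2 : ℂ) • q 0 ^ 2)) = -if d = Finsupp.single 0 2 then 1 / 2 else 0 := by
    rw [h0, X_pow_eq, map_neg, coeff_smul, coeff_monomial]
    split_ifs <;> simp
  have h2 : PowerSeries.coeff 1 (PowerSeries.X * PowerSeries.mk fun i => pderiv ℂ i F) =
      pderiv ℂ 0 F := by
    rw [← zero_add 1, PowerSeries.coeff_succ_X_mul, PowerSeries.coeff_mk]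
  have h3 (n : ℕ) : coeff (d - Finsupp.single n 1)
      (PowerSeries.coeff n (PowerSeries.X * PowerSeries.mk fun i => pderiv ℂ i F)) =
      if n = 0 then 0 else
        coeff (d - Finsupp.single n 1 + Finsupp.single (n - 1) 1) F *
          ((d - Finsupp.single n 1 : ℕ →₀ ℕ) (n - 1) + 1) := by
    rcases n with _ | n
    · simp
    · rw [PowerSeries.coeff_succ_X_mul, PowerSeries.coeff_mk, coeff_pderiv, if_neg (by simp)]
      rfl
  rw [coeff_ell, h1, h2, coeff_pderiv]
  simp only [h3]
  constructor <;> intro h <;> linear_combination -h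

theorem single_tsub_add {d : ℕ →₀ ℕ} {n : ℕ} (hn : n ∈ d.support) :
    d - Finsupp.single n 1 + Finsupp.single n 1 = d :=
  tsub_add_cancel_of_le (by simpa [Nat.one_le_iff_ne_zero] using hn)

/-- A monomial of defect `3` contains `t_0`, since otherwise its degree is at most its weight. The
string equation then expresses its coefficient through monomials of degree one less. -/
theorem eq_of_stringEq {F G : Potential} (hF : StringEq F) (hG : StringEq G)
    (hF' : ∀ d, coeff d F ≠ 0 → defect d = 3) (hG' : ∀ d, coeff d G ≠ 0 → defect d = 3) :
    F = G := by
  rw [stringEq_iff_coeff] at hF hG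
  ext d
  induction hn : d.degree using Nat.strong_induction_on generalizing d with
  | _ n ih =>
    by_cases hd : defect d = 3
    · have h0 : 0 ∈ d.support := by
        by_contra h0
        have h1 : d.degree ≤ Finsupp.weight (fun i => i) d := by
          rw [Finsupp.degree_apply, Finsupp.weight_apply, Finsupp.sum]
          refine Finset.sum_le_sum fun i hi => ?_
          refine Nat.le_mul_of_pos_right _ (Nat.pos_of_ne_zero ?_)
          rintro rfl
          exact h0 hi
        rw [defect_eq_three_iff] at hd
        omega
      obtain ⟨e, rfl⟩ : ∃ e, d = e + Finsupp.single 0 1 := ⟨_, (single_tsub_add h0).symm⟩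
      have h2 : ((e 0 : ℂ) + 1) ≠ 0 := Nat.cast_add_one_ne_zero _
      refine mul_right_cancel₀ h2 ?_
      rw [hF, hG]
      congr 1
      refine Finset.sum_congr rfl fun k hk => ?_
      rw [ih _ ?_ _ rfl]
      rw [map_add, Finsupp.degree_single, degree_sub_single hk, ← hn, map_add,
        Finsupp.degree_single]
      exact Nat.lt_succ_self _
    · rw [not_imp_comm.1 (hF' d) hd, not_imp_comm.1 (hG' d) hd]

/-- On monomials of defect `2` the equation reads `w! = (w - 1)! ∑ n d_n` up to a common factor, and
`∑ n d_n = w`. On the others all terms vanish. -/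
theorem stringEq_pointPotential : StringEq pointPotential := by
  rw [stringEq_iff_coeff]
  intro d
  set w := Finsupp.weight (fun i : ℕ => i) d with hw
  have hd0 : defect (d + Finsupp.single 0 1) = defect d + 1 := by
    rw [map_add, defect_single, Nat.cast_zero, sub_zero]
  have hdn {n : ℕ} (hn : n ∈ d.support) (hn0 : n ≠ 0) :
      defect (d - Finsupp.single n 1 + Finsupp.single (n - 1) 1) = defect d + 1 := by
    have h := congrArg defect (single_tsub_add hn)
    rw [map_add, defect_single] at h
    rw [map_add, defect_single, ← h, Nat.cast_pred (Nat.pos_of_ne_zero hn0)]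
    ring
  by_cases hd : defect d = 2
  · have h1 : coeff (d + Finsupp.single 0 1) pointPotential * (d 0 + 1) =
        (w.factorial : ℂ) / symmetryFactor d := by
      rw [coeff_pointPotential, if_pos (by rw [hd0, hd]; rfl), symmetryFactor_add_single, map_add,
        Finsupp.weight_single, smul_zero, add_zero, Nat.factorial_zero, Nat.cast_one, mul_one]
      have h2 : ((d 0 : ℂ) + 1) ≠ 0 := Nat.cast_add_one_ne_zero _
      have h3 := symmetryFactor_ne_zero d
      field_simp
      rfl
    have h2 : ∀ n ∈ d.support, (if n = 0 then 0 else
        coeff (d - Finsupp.single n 1 + Finsupp.single (n - 1) 1) pointPotential *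
          (((d - Finsupp.single n 1 : ℕ →₀ ℕ) (n - 1) : ℂ) + 1)) =
        ((w - 1).factorial : ℂ) / symmetryFactor d * (d n * n : ℕ) := by
      intro n hn
      rcases n with _ | n
      · simp
      rw [if_neg (Nat.succ_ne_zero n), coeff_pointPotential,
        if_pos (by rw [hdn hn (Nat.succ_ne_zero n), hd]; rfl), Nat.add_sub_cancel]
      set b := d - Finsupp.single (n + 1) 1 with hb
      have h3 : b + Finsupp.single (n + 1) 1 = d := single_tsub_add hn
      have h4 : Finsupp.weight (fun i : ℕ => i) (b + Finsupp.single n 1) = w - 1 := by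
        rw [hw, ← h3, map_add, map_add, Finsupp.weight_single, Finsupp.weight_single]
        simp only [one_smul]
        omega
      rw [h4, symmetryFactor_add_single, ← h3, symmetryFactor_add_single, Finsupp.add_apply,
        Finsupp.single_eq_same, Nat.factorial_succ]
      have h5 : ((b n : ℂ) + 1) ≠ 0 := Nat.cast_add_one_ne_zero _
      have h6 : ((b (n + 1) : ℂ) + 1) ≠ 0 := Nat.cast_add_one_ne_zero _
      have h7 := symmetryFactor_ne_zero b
      have h8 : ((n : ℂ) + 1) ≠ 0 := Nat.cast_add_one_ne_zero _
      have h9 : (n.factorial : ℂ) ≠ 0 := Nat.cast_ne_zero.2 n.factorial_ne_zero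
      push_cast
      field_simp
    rw [h1, Finset.sum_congr rfl h2, ← Finset.mul_sum, ← Nat.cast_sum]
    have h3 : ∑ n ∈ d.support, d n * n = w := by
      rw [hw, Finsupp.weight_apply]
      rfl
    rw [h3]
    have h4 := defect_eq d
    -- For `w = 0` the sum is zero and `d` must be `t_0²`, where the inhomogeneous term supplies the
    -- `1/2`.
    by_cases h5 : w = 0
    · have h6 : d = Finsupp.single 0 2 := by
        have h7 : d = Finsupp.single 0 (d 0) := by
          ext i
          by_cases hi : i = 0
          · rw [hi, Finsupp.single_eq_same]
          · rw [Finsupp.single_eq_of_ne hi]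
            by_contra h8
            have := Finsupp.le_weight_of_ne_zero' (w := fun i : ℕ => i) h8
            omega
        rw [h7, Finsupp.degree_single, ← h7, ← hw, h5, hd] at h4
        rw [h7]
        congr 1
        omega
      rw [if_pos h6, h5, h6]
      simp [symmetryFactor]
    · rw [if_neg]
      · obtain ⟨u, hu⟩ := Nat.exists_eq_succ_of_ne_zero h5
        rw [hu, Nat.succ_sub_one, Nat.factorial_succ]
        push_cast
        ring
      · rintro rfl
        exact h5 (by rw [hw, Finsupp.weight_single, smul_zero])
  · rw [coeff_pointPotential, if_neg (by rw [hd0]; omega), if_neg, Finset.sum_eq_zero]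
    · simp
    · intro n hn
      by_cases hn0 : n = 0
      · rw [if_pos hn0]
      · rw [if_neg hn0, coeff_pointPotential, if_neg (by rw [hdn hn hn0]; omega), zero_mul]
    · rintro rfl
      refine hd ?_
      rw [defect_eq, Finsupp.degree_single, Finsupp.weight_single]
      simp

theorem isSymplectic_one : IsSymplectic (1 : PowerSeries ℂ) :=
  ⟨by simp, by simp⟩

theorem represents_pointPotential : ∃ v, Represents 1 v pointPotential := by
  obtain ⟨v, hv⟩ := exists_ell_jet_eq_zero (J := 1) (by simp)
  refine ⟨v, hv, ?_⟩
  have h : Represents 1 v ((1 / 2 : ℂ) • bil (quotSeries (jet 1 v))) := ⟨hv, rfl⟩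
  refine eq_of_stringEq stringEq_pointPotential (h.mem_GW0 isSymplectic_one).2.1 (fun d hd => ?_)
    fun d hd => ?_
  · by_contra h3
    rw [coeff_pointPotential, if_neg h3] at hd
    exact hd rfl
  · refine h.hasDefect (r := diagSubmonoid) (fun a => rfl) (fun i hi => ?_) (by simp)
      (d.degree + 1) d (Nat.lt_succ_self _) hd
    rw [PowerSeries.coeff_one] at hi
    by_cases h0 : i = 0
    · rw [h0]
      rfl
    · exact absurd (if_neg h0) hi

end PointPotential

end FormalGW

/-! ### The torsor structure and the main theorem -/

namespace FormalGW

open MvPowerSeries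

theorem mem_Gminus_iff {S : (PowerSeries ℂ)ˣ} :
    S ∈ Gminus ↔ IsSymplectic (S : PowerSeries ℂ) :=
  Iff.rfl

theorem IsSymplectic.exists_Gminus {J : PowerSeries ℂ} (hJ : IsSymplectic J) :
    ∃ S : Gminus, ((S : (PowerSeries ℂ)ˣ) : PowerSeries ℂ) = J := by
  have hu : IsUnit J := PowerSeries.isUnit_iff_constantCoeff.2 (by rw [hJ.1]; exact isUnit_one)
  exact ⟨⟨hu.unit, hJ⟩, rfl⟩

theorem coe_Gminus_inv (S : Gminus) :
    (((S⁻¹ : Gminus) : (PowerSeries ℂ)ˣ) : PowerSeries ℂ) =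
      ((S : (PowerSeries ℂ)ˣ) : PowerSeries ℂ)⁻¹ := by
  refine (PowerSeries.eq_inv_iff_mul_eq_one ?_).2 ?_
  · rw [(mem_Gminus_iff.1 S.2).1]
    exact one_ne_zero
  · rw [Subgroup.coe_inv, Units.inv_mul]

/-- The potential `F` is attached to `J ∈ G_-` and some solution `v` of `∑ A_k q_k = 0`. -/
def Attached (J : Gminus) (F : Potential) : Prop :=
  ∃ v, Represents ((J : (PowerSeries ℂ)ˣ) : PowerSeries ℂ) v F

namespace Attached

variable {J J' : Gminus} {F F' : Potential}

theorem mem_GW0 (h : Attached J F) : F ∈ GW0 :=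
  h.elim fun _ hv => hv.mem_GW0 J.2

theorem exists_of_mem_GW0 (hF : F ∈ GW0) : ∃ J, Attached J F := by
  obtain ⟨J, v, hJ, h⟩ := exists_represents hF
  obtain ⟨S, rfl⟩ := hJ.exists_Gminus
  exact ⟨S, v, h⟩

theorem unique (h : Attached J F) (h' : Attached J F') : F = F' := by
  obtain ⟨v, hv⟩ := h
  obtain ⟨v', hv'⟩ := h'
  rw [hv.2, hv'.2, ell_jet_unique (Represents.coeff_zero_eq_one J.2) hv.1 hv'.1]

theorem isLocallyFinite (h : Attached J F) (S : Gminus) :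
    IsLocallyFinite (substTerm ((S : (PowerSeries ℂ)ˣ) : PowerSeries ℂ) F) :=
  h.elim fun _ hv => (hv.tame J.2).isLocallyFinite_substTerm (mem_Gminus_iff.1 S.2).1

theorem act (h : Attached J F) (S : Gminus) :
    Attached (S⁻¹ * J) (act ((S : (PowerSeries ℂ)ˣ) : PowerSeries ℂ) F) := by
  obtain ⟨v, hv⟩ := h
  have hS : IsSymplectic ((S : (PowerSeries ℂ)ˣ) : PowerSeries ℂ)⁻¹ := by
    rw [← coe_Gminus_inv]
    exact (S⁻¹).2
  refine ⟨phi ((S : (PowerSeries ℂ)ˣ) : PowerSeries ℂ) v, ?_⟩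
  have := hv.act J.2 (mem_Gminus_iff.1 S.2).1 hS
  rwa [← coe_Gminus_inv, ← Units.val_mul, ← Subgroup.coe_mul] at this

theorem mul_right (h : Attached J F) {T : Gminus} (hT : T ∈ stringFlow) : Attached (J * T) F := by
  obtain ⟨v, hv⟩ := h
  obtain ⟨a, ha⟩ := hT
  refine ⟨-C a + v, ?_⟩
  rw [Represents, Subgroup.coe_mul, Units.val_mul, ha, jet_mul_exp, add_neg_cancel_left]
  exact hv

/-- The coefficients of `A` are second derivatives of `F`, so both encodings have the same `A`.
Evaluating it at `t = 0` compares `J` and `J'`. -/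
theorem inv_mul_mem (h : Attached J F) (h' : Attached J' F) : J⁻¹ * J' ∈ stringFlow := by
  obtain ⟨v, hv⟩ := h
  obtain ⟨v', hv'⟩ := h'
  have hjet : jet ((J : (PowerSeries ℂ)ˣ) : PowerSeries ℂ) v =
      jet ((J' : (PowerSeries ℂ)ˣ) : PowerSeries ℂ) v' := by
    ext1 k
    rcases k with _ | k
    · rw [Represents.coeff_zero_jet J.2, Represents.coeff_zero_jet J'.2]
    · rw [hv.coeff_succ_jet J.2, hv'.coeff_succ_jet J'.2]
  have h := congrArg (PowerSeries.map constantCoeff) hjet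
  rw [map_constantCoeff_jet, map_constantCoeff_jet] at h
  have h1 := congrArg (· * PowerSeries.rescale (-constantCoeff v') (PowerSeries.exp ℂ)) h
  simp only [mul_assoc, PowerSeries.exp_mul_exp_eq_exp_add, add_neg_cancel] at h1
  refine ⟨constantCoeff v + -constantCoeff v', ?_⟩
  rw [Subgroup.coe_mul, Subgroup.coe_inv, Units.val_mul, Units.inv_mul_eq_iff_eq_mul, h1]
  simp [PowerSeries.rescale_zero]

theorem iff_inv_mul_mem (h : Attached J F) : Attached J' F ↔ J⁻¹ * J' ∈ stringFlow :=
  ⟨h.inv_mul_mem, fun hJ => by simpa using h.mul_right hJ⟩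

/-- Since `S` sends `J` to `S⁻¹ J`, questions about the action become computations in the
commutative group `G_-`. -/
theorem act_eq_iff (h : Attached J F) (h' : Attached J' F') (S : Gminus) :
    FormalGW.act ((S : (PowerSeries ℂ)ˣ) : PowerSeries ℂ) F = F' ↔
      S⁻¹ * (J * J'⁻¹) ∈ stringFlow := by
  have h1 : S⁻¹ * (J * J'⁻¹) = J'⁻¹ * (S⁻¹ * J) := by
    rw [mul_comm J'⁻¹, mul_assoc]
  rw [h1, ← h'.iff_inv_mul_mem]
  refine ⟨fun hS => hS ▸ h.act S, fun hS => (h.act S).unique hS⟩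

end Attached

theorem attached_one_pointPotential : Attached 1 pointPotential :=
  represents_pointPotential

theorem act_mem_GW0 (S : Gminus) (F : GW0) :
    act ((S : (PowerSeries ℂ)ˣ) : PowerSeries ℂ) F ∈ GW0 := by
  obtain ⟨J, hJ⟩ := Attached.exists_of_mem_GW0 F.2
  exact (hJ.act S).mem_GW0

/-- The action of the quotient of `G_-` by the string flow. -/
noncomputable def quotientSMul (g : Gminus ⧸ stringFlow) (F : GW0) : GW0 :=
  Quotient.liftOn' g (fun S => ⟨act ((S : (PowerSeries ℂ)ˣ) : PowerSeries ℂ) F, act_mem_GW0 S F⟩)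
    fun S T hST => Subtype.ext <| by
      obtain ⟨J, hJ⟩ := Attached.exists_of_mem_GW0 F.2
      refine (hJ.act_eq_iff (hJ.act T) S).2 ?_
      rw [QuotientGroup.leftRel_apply] at hST
      convert hST using 1
      group

theorem coe_quotientSMul_mk (S : Gminus) (F : GW0) :
    (quotientSMul (S : Gminus ⧸ stringFlow) F : Potential) =
      act ((S : (PowerSeries ℂ)ˣ) : PowerSeries ℂ) F :=
  rfl

/-- The action of the quotient of `G_-` by the string flow, as a group action. -/
noncomputable abbrev quotientMulAction : MulAction (Gminus ⧸ stringFlow) GW0 where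
  smul := quotientSMul
  one_smul F := Subtype.ext <| by
    obtain ⟨J, hJ⟩ := Attached.exists_of_mem_GW0 F.2
    refine (hJ.act_eq_iff hJ 1).2 ?_
    simp [one_mem]
  mul_smul g h F := Subtype.ext <| by
    induction g using QuotientGroup.induction_on with
    | H S =>
      induction h using QuotientGroup.induction_on with
      | H T =>
        obtain ⟨J, hJ⟩ := Attached.exists_of_mem_GW0 F.2
        refine (hJ.act_eq_iff ((hJ.act T).act S) (S * T)).2 ?_
        convert one_mem stringFlow using 1
        rw [mul_inv_rev, mul_inv_rev S⁻¹, mul_inv_rev T⁻¹, inv_inv, inv_inv, mul_comm T⁻¹]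
        group

theorem bijOn_act_oddExp :
    Set.BijOn (fun a : {n : ℕ // Odd n ∧ 3 ≤ n} → ℂ => act (oddExp a) pointPotential)
      Set.univ GW0 := by
  choose E hE using fun a => (isSymplectic_oddExp a).exists_Gminus
  simp only [← hE]
  refine ⟨fun a _ => (attached_one_pointPotential.act (E a)).mem_GW0, fun a _ b _ hab => ?_,
    fun F hF => ?_⟩
  · obtain ⟨c, hc⟩ := (attached_one_pointPotential.act_eq_iff
      (attached_one_pointPotential.act (E b)) (E a)).1 hab
    rw [one_mul, mul_one, inv_inv, Subgroup.coe_mul, Subgroup.coe_inv, Units.val_mul,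
      Units.inv_mul_eq_iff_eq_mul, hE, hE] at hc
    exact oddExp_injective_mod hc
  · obtain ⟨J, hJ⟩ := Attached.exists_of_mem_GW0 hF
    -- The inverse of `J` is factored because `S` sends the point potential to the one attached to
    -- `S⁻¹`.
    obtain ⟨a, c, hac⟩ := (mem_Gminus_iff.1 (J⁻¹).2).exists_oddExp
    refine ⟨a, Set.mem_univ a, (attached_one_pointPotential.act_eq_iff hJ (E a)).2 ⟨c, ?_⟩⟩
    rw [one_mul, Subgroup.coe_mul, Subgroup.coe_inv, Units.val_mul, Units.inv_mul_eq_iff_eq_mul,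
      hE]
    exact hac

end FormalGW

theorem mainTheorem1 :
    Set.BijOn (fun a : {n : ℕ // Odd n ∧ 3 ≤ n} → ℂ =>
        FormalGW.act (FormalGW.oddExp a) FormalGW.pointPotential)
      Set.univ FormalGW.GW0 ∧
    (∀ a : {n : ℕ // Odd n ∧ 3 ≤ n} → ℂ, ∃ S : FormalGW.Gminus,
      ((S : (PowerSeries ℂ)ˣ) : PowerSeries ℂ) = FormalGW.oddExp a) ∧
    (∀ (S : FormalGW.Gminus) (F : FormalGW.GW0),
      FormalGW.IsLocallyFinite
        (FormalGW.substTerm ((S : (PowerSeries ℂ)ˣ) : PowerSeries ℂ) (F : FormalGW.Potential))) ∧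
    ∃ _ : MulAction (FormalGW.Gminus ⧸ FormalGW.stringFlow) FormalGW.GW0,
      (∀ (S : FormalGW.Gminus) (F : FormalGW.GW0),
        (((S : FormalGW.Gminus ⧸ FormalGW.stringFlow) • F : FormalGW.GW0) : FormalGW.Potential) =
          FormalGW.act ((S : (PowerSeries ℂ)ˣ) : PowerSeries ℂ) (F : FormalGW.Potential)) ∧
      ∀ F F' : FormalGW.GW0, ∃! g : FormalGW.Gminus ⧸ FormalGW.stringFlow, g • F = F' := by
  refine ⟨FormalGW.bijOn_act_oddExp, fun a => (FormalGW.isSymplectic_oddExp a).exists_Gminus,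
    fun S F => ?_, FormalGW.quotientMulAction, fun S F => FormalGW.coe_quotientSMul_mk S F,
    fun F F' => ?_⟩
  · obtain ⟨J, hJ⟩ := FormalGW.Attached.exists_of_mem_GW0 F.2
    exact hJ.isLocallyFinite S
  · obtain ⟨J, hJ⟩ := FormalGW.Attached.exists_of_mem_GW0 F.2
    obtain ⟨J', hJ'⟩ := FormalGW.Attached.exists_of_mem_GW0 F'.2
    refine ⟨((J * J'⁻¹ : FormalGW.Gminus) : FormalGW.Gminus ⧸ FormalGW.stringFlow),
      Subtype.ext ((hJ.act_eq_iff hJ' _).2 ?_), fun g hg => ?_⟩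
    · rw [inv_mul_cancel]
      exact one_mem _
    · induction g using QuotientGroup.induction_on with
      | H S => exact QuotientGroup.eq.2 ((hJ.act_eq_iff hJ' S).1 (congrArg Subtype.val hg))
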